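/- **Setting.** Let $\mathbb L$ be the square, triangular or hexagonal lattice, embedded in $\mathbb R^2$ as a regular tessellation with edges of length $1$, one of whose sites is the origin $o$; $V(\mathbb L)$ is its set of sites, $|\cdot|$ is the Euclidean norm, and a configuration is identified with its set $\omega\subset V(\mathbb L)$ of open sites. An *enhancement function* (of range $R_0<\infty$) is a map $\phi_o$ from configurations to configurations such that $\phi_o(\omega)$ depends only on the restriction of $\omega$ to the ball of radius $R_0$ centred at $o$ and is contained in that ball. It is extended by translations to $\phi_x(\omega)=x+\phi_o(\tau_x\omega)$, $\tau_x\omega=\{y: y+x\in\omega\}$. (The sites of the hexagonal lattice form two classes modulo translations preserving the lattice; there one such function is given, arbitrarily, for each of the two sites of a fundamental cell, localized in the ball centred at that site, and each is extended by the translations preserving the lattice.) The enhancement is *monotonic* if $\omega\subset\omega'$ implies $\phi_o(\omega)\subset\phi_o(\omega')$ (for both functions, on the hexagonal lattice). A path is *self-repelling* if its sites are distinct and none of them is adjacent to any other site of the path except its neighbours in the path. The enhancement is *essential* if there is a configuration $\omega$ containing no doubly-infinite self-repelling path such that $\omega\cup\phi_o(\omega)$ contains one (on the hexagonal lattice: for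 at least one of the two sites of the cell in the role of $o$); otherwise it is *nonessential*. For $p,s\in[0,1]$ let each site belong to $\omega$ independently with probability $p$ and, independently of $\omega$, let each site belong to a random set $\alpha$ (the activated sites) independently with probability $s$. The enhanced configuration is $\hat\omega=\omega\cup\bigcup_{x\in\alpha}\phi_x(\omega)$. Let $\theta(p)$ be the probability that $o$ lies in an infinite open cluster of $\omega$, let $\tau_p(x)$ be the probability that $o$ and $x$ lie in the same open cluster of $\omega$, and let $\theta(p,s)$, $\tau_{p,s}(x)$ be the same probabilities for $\hat\omega$. Let $p_c=\inf\{p:\theta(p)>0\}$. The correlation lengths $\xi(p),\xi(p,s)\in[0,\infty]$ are defined by $$\xi(p)^{-1}=\lim_{|x|\to\infty}\Big\{-\frac1{|x|}\log\tau_p(x)\Big\},\qquad \xi(p,s)^{-1}=\lim_{|x|\to\infty}\Big\{-\frac1{|x|}\log\tau_{p,s}(x)\Big\}.$$ **Lemma.** For every monotonic nonessential enhancement of site percolation on $\mathbb L$ there exist constants $0<c_1,c_2<\infty$ and $r<\infty$ such that, for all $s\in[0,1]$, 1. $\theta(p)\le\theta(p,s)\le c_1\,\theta(p)$ for all $p\in(p_c,1]$;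 2. $\tau_p(x)\le\tau_{p,s}(x)\le p^{-c_2}\,\tau_p(x)$ for all $p\in(0,p_c]$ and all sites $x$ with $|x|\ge r$; 3. $\xi(p,s)=\xi(p)$ for all $p\in(0,p_c]$, in the following sense: for every way of letting $|x|\to\infty$ (through all sites, along a direction, along a sequence; in general, along any filter on $V(\mathbb L)$ finer than that of $|x|\to\infty$), the limit defining $\xi(p,s)$ exists if and only if the one defining $\xi(p)$ does, with the same value; and, whether or not the limits exist, the two quantities obtained by replacing $\lim$ by $\liminf$ in the definitions agree. -/

import Mathlib

open Set Filter Topology MeasureTheory ProbabilityTheory unitInterval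
open scoped ENNReal

noncomputable section

namespace EnhPerc

/-! ### The three lattices -/

/-- The three planar lattices under consideration. -/
inductive Lattice where
  | square
  | triangular
  | hexagonal

/-- Number of classes of sites modulo translations that preserve the lattice. -/
def Lattice.numClasses : Lattice → ℕ
  | .square => 1
  | .triangular => 1
  | .hexagonal => 2

instance (L : Lattice) : NeZero L.numClasses :=
  ⟨by cases L <;> simp [Lattice.numClasses]⟩

/-- The sites: the site `((a, b), k)` is the translate by `a • e₁ + b • e₂` of the `k`-th site of
the fundamental cell (see `pos` for its position in the plane). -/
abbrev Site (L : Lattice) : Type := (ℤ × ℤ) × Fin L.numClasses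

/-- First generator of the group of translations preserving the lattice (edges have length 1). -/
def Lattice.e₁ : Lattice → EuclideanSpace ℝ (Fin 2)
  | .square => !₂[1, 0]
  | .triangular => !₂[1, 0]
  | .hexagonal => !₂[3 / 2, √3 / 2]

/-- Second generator of the group of translations preserving the lattice. -/
def Lattice.e₂ : Lattice → EuclideanSpace ℝ (Fin 2)
  | .square => !₂[0, 1]
  | .triangular => !₂[1 / 2, √3 / 2]
  | .hexagonal => !₂[3 / 2, -(√3 / 2)]

/-- Position of a site in the plane. The cell of the hexagonal lattice consists of the two sites
`(0, 0)` and `(1, 0)`; that of the square and of the triangular lattice only of `(0, 0)`. -/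
def pos {L : Lattice} (x : Site L) : EuclideanSpace ℝ (Fin 2) :=
  (x.1.1 : ℝ) • L.e₁ + (x.1.2 : ℝ) • L.e₂ + ((x.2 : ℕ) : ℝ) • !₂[1, 0]

/-- The graph: two sites are adjacent iff they are at Euclidean distance 1 (the edge length of
the regular tessellation). -/
def graph (L : Lattice) : SimpleGraph (Site L) where
  Adj x y := dist (pos x) (pos y) = 1
  symm := ⟨fun x y h => by rw [dist_comm]; exact h⟩
  loopless := ⟨fun x h => by simp at h⟩

/-- The origin, a site of the lattice. -/
def origin (L : Lattice) : Site L := ((0, 0), 0)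

/-- Translation of a site by the lattice vector with coordinates `v`. -/
def translate {L : Lattice} (v : ℤ × ℤ) (x : Site L) : Site L := (v + x.1, x.2)

/-! ### Enhancements

A configuration is identified with its set `ω : Set (Site L)` of open sites. -/

/-- An enhancement function. One local function is given for each class `k` of sites modulo
translations; it describes the effect of activating the enhancement at the site `((0, 0), k)` of
the fundamental cell. For the square and the triangular lattice there is a single function,
attached to the origin. -/
structure Enhancement (L : Lattice) where
  /-- the local functions -/
  toFun : Fin L.numClasses → Set (Site L) → Set (Site L)
  /-- the enhancement range `R₀` -/
  range : ℝ
  /-- the value depends only on the configuration in the ball of radius `R₀` -/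
  depends_only : ∀ (k : Fin L.numClasses) (ω ω' : Set (Site L)),
    (∀ y : Site L, dist (pos y) (pos (((0, 0), k) : Site L)) ≤ range → (y ∈ ω ↔ y ∈ ω')) →
      toFun k ω = toFun k ω'
  /-- the value is contained in the ball of radius `R₀` -/
  subset_ball : ∀ (k : Fin L.numClasses) (ω : Set (Site L)), ∀ y ∈ toFun k ω,
    dist (pos y) (pos (((0, 0), k) : Site L)) ≤ range

/-- The extension by translations, `φ_x(ω) = v + φ_k(τ_v ω)` for the site `x = v + ((0, 0), k)`,
where `τ_v ω = {y | v + y ∈ ω}`. -/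
def Enhancement.at {L : Lattice} (φ : Enhancement L) (x : Site L) (ω : Set (Site L)) :
    Set (Site L) :=
  translate x.1 '' φ.toFun x.2 {y | translate x.1 y ∈ ω}

/-- The enhanced configuration; `α` is the set of sites where the enhancement is activated. -/
def Enhancement.enhance {L : Lattice} (φ : Enhancement L) (ω α : Set (Site L)) : Set (Site L) :=
  ω ∪ ⋃ x ∈ α, φ.at x ω

/-- Monotonic enhancements: `ω ⊆ ω'` implies `φ(ω) ⊆ φ(ω')`. -/
def Enhancement.IsMonotonic {L : Lattice} (φ : Enhancement L) : Prop :=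
  ∀ (k : Fin L.numClasses) (ω ω' : Set (Site L)), ω ⊆ ω' → φ.toFun k ω ⊆ φ.toFun k ω'

/-- `ω` contains a doubly-infinite self-repelling path: a two-sided sequence of distinct sites of
`ω` in which two sites are adjacent iff they are consecutive. -/
def HasBiinfiniteSelfRepellingPath {L : Lattice} (ω : Set (Site L)) : Prop :=
  ∃ γ : ℤ → Site L, Function.Injective γ ∧ (∀ i, γ i ∈ ω) ∧
    ∀ i j : ℤ, (graph L).Adj (γ i) (γ j) ↔ (j = i + 1 ∨ i = j + 1)

/-- Essential enhancements: in some configuration without a doubly-infinite self-repelling path,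
one activation of the enhancement (at the origin, or, on the hexagonal lattice, at one of the two
sites of the fundamental cell) produces such a path. -/
def Enhancement.IsEssential {L : Lattice} (φ : Enhancement L) : Prop :=
  ∃ (k : Fin L.numClasses) (ω : Set (Site L)), ¬ HasBiinfiniteSelfRepellingPath ω ∧
    HasBiinfiniteSelfRepellingPath (ω ∪ φ.at ((0, 0), k) ω)

/-! ### Percolation -/

/-- The open cluster of `x` in `ω`: the sites joined to `x` by a path all of whose sites
(including both ends) are open. It is empty when `x` is closed. -/
def cluster {L : Lattice} (ω : Set (Site L)) (x : Site L) : Set (Site L) :=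
  {y | ∃ w : (graph L).Walk x y, ∀ z ∈ w.support, z ∈ ω}

/-- Bernoulli product measure: every site belongs to the random set independently with
probability `p`. -/
def bernoulliSites (L : Lattice) (p : I) : Measure (Set (Site L)) :=
  setBernoulli (Set.univ : Set (Site L)) p

/-- Joint law of the initial configuration and of the independent set of activated sites. -/
def jointLaw (L : Lattice) (p s : I) : Measure (Set (Site L) × Set (Site L)) :=
  (bernoulliSites L p).prod (bernoulliSites L s)

/-- Percolation probability `θ(p)` of the independent process. -/
def theta (L : Lattice) (p : I) : ℝ :=
  (bernoulliSites L p).real {ω | (cluster ω (origin L)).Infinite}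

/-- Percolation probability `θ(p, s)` of the enhanced process. -/
def Enhancement.theta {L : Lattice} (φ : Enhancement L) (p s : I) : ℝ :=
  (jointLaw L p s).real {c | (cluster (φ.enhance c.1 c.2) (origin L)).Infinite}

/-- Critical probability `p_c` of the independent process. -/
def pc (L : Lattice) : ℝ := sInf ((fun p : I => (p : ℝ)) '' {p : I | 0 < theta L p})

/-- Connectivity function `τ_p(x)` of the independent process. -/
def tau (L : Lattice) (p : I) (x : Site L) : ℝ :=
  (bernoulliSites L p).real {ω | x ∈ cluster ω (origin L)}

/-- Connectivity function `τ_{p,s}(x)` of the enhanced process. -/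
def Enhancement.tau {L : Lattice} (φ : Enhancement L) (p s : I) (x : Site L) : ℝ :=
  (jointLaw L p s).real {c | x ∈ cluster (φ.enhance c.1 c.2) (origin L)}

/-- The filter of neighbourhoods of infinity: `|x| → ∞`. -/
def atInfinity (L : Lattice) : Filter (Site L) := comap (fun x => ‖pos x‖) atTop

/-- The rate `-(1 / |x|) log T(x)` of a connectivity function `T`. -/
def decayRate {L : Lattice} (T : Site L → ℝ) (x : Site L) : ℝ≥0∞ :=
  ENNReal.ofReal (-(1 / ‖pos x‖) * Real.log (T x))

/-- `ξ⁻¹ = lim -(1 / |x|) log T(x)`, the limit existing along the filter `l`. -/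
def IsCorrelationLength {L : Lattice} (T : Site L → ℝ) (l : Filter (Site L)) (ξ : ℝ≥0∞) : Prop :=
  Tendsto (decayRate T) l (𝓝 ξ⁻¹)

/-- The correlation length along `l`, with the lower limit of the decay rates in place of the
limit, so that it is defined whether or not the limit exists, and agrees with it if it does. -/
def correlationLength {L : Lattice} (T : Site L → ℝ) (l : Filter (Site L)) : ℝ≥0∞ :=
  (liminf (decayRate T) l)⁻¹

end EnhPerc

end

/-!
The heart of the matter is deterministic: a monotonic nonessential enhancement `φ` connects no two
sites that are far from the site `z` where it is activated, unless they were connected before.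
Let `D` be a box around `z` containing the range of `φ`, and consider an excursion into `D` of a
path in `ω ∪ φ_z(ω)`, from a site `x` to a site `y` on the outer boundary of `D`. If `x` and `y`
are equal or adjacent, there is nothing to prove. Otherwise `x` and `y` are the starting points of
two induced rays outside `D` with no edge between them (`hasExitRays_box`). Replace the
configuration outside `D` by these rays; this does not affect `φ_z`. After the activation, the two
rays are joined through `D`, so that there is a doubly-infinite self-repelling path
(`hasBiinfinite_of_reachable`). As `φ` is nonessential, such a path exists before the activation.
But a doubly-infinite path in the union of a finite set and two rays has to use both rays, so
that `x` and `y` are connected in `(ω ∩ D) ∪ {x, y}` (`reachable_of_hasBiinfinite`). Hence every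
excursion can be replaced by a path in `ω` (`reachable_of_reachable_union`).

If `ω` contains a long segment of sites around each of `x` and `y`, both can be moved out of any
given box without leaving `ω`. A path in the enhanced configuration uses finitely many
activations, which are removed one at a time, by monotonicity; thus `x` and `y` are connected in
the enhanced configuration only if they are connected in the initial one after the segments around
them have been opened, and similarly for infinite clusters
(`Enhancement.exists_cluster_comparison`). Opening `K` sites increases probabilities at most by the
factor `p ^ (-K)`, since an event of the form `ω ∪ B ∈ A` is independent of the configuration in
`B` (`setBernoulli_union_mul_le`). This bounds `τ_{p,s}` and `θ(p, s)`; in the latter case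
uniformly in `p > p_c`, as `p_c > 0` by counting paths (`le_pc`). A constant factor is invisible
in the exponential decay rates (`decayRate_asymptotics`).
-/

noncomputable section

namespace EnhPerc

/-! ### Open subgraphs, geodesics and rays -/

section Graph

variable {V : Type*} {G : SimpleGraph V}

/-- The subgraph of `G` consisting of the edges with both ends in `S`, on the full vertex set. -/
def openGraph (G : SimpleGraph V) (S : Set V) : SimpleGraph V where
  Adj x y := G.Adj x y ∧ x ∈ S ∧ y ∈ S
  symm := ⟨fun _ _ h => ⟨h.1.symm, h.2.2, h.2.1⟩⟩
  loopless := ⟨fun _ h => h.1.ne rfl⟩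

lemma openGraph_mono {S T : Set V} (h : S ⊆ T) : openGraph G S ≤ openGraph G T :=
  fun _ _ hxy => ⟨hxy.1, h hxy.2.1, h hxy.2.2⟩

lemma mem_of_reachable_openGraph {S : Set V} {x y : V} (hx : x ∈ S)
    (h : (openGraph G S).Reachable x y) : y ∈ S := by
  rw [SimpleGraph.reachable_iff_reflTransGen] at h
  induction h with
  | refl => exact hx
  | tail _ h _ => exact h.2.2

/-- A geodesic, as a sequence of vertices labelled by their distance to its start. -/
lemma exists_geodesic {H : SimpleGraph V} {x y : V} (h : H.Reachable x y) :
    ∃ (n : ℕ) (p : ℕ → V), p 0 = x ∧ p n = y ∧ (∀ i < n, H.Adj (p i) (p (i + 1))) ∧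
      ∀ i ≤ n, H.Reachable x (p i) ∧ H.dist x (p i) = i := by
  obtain ⟨w, hw⟩ := h.exists_walk_length_eq_dist
  refine ⟨w.length, w.getVert, w.getVert_zero, w.getVert_length,
    fun i hi => w.adj_getVert_succ hi, fun i hi => ⟨(w.take i).reachable, ?_⟩⟩
  have h1 : H.dist x (w.getVert i) ≤ i :=
    (SimpleGraph.dist_le (w.take i)).trans (by simp)
  have h2 : H.dist (w.getVert i) y ≤ w.length - i :=
    (SimpleGraph.dist_le (w.drop i)).trans (by simp)
  obtain ⟨q₁, hq₁⟩ := (w.take i).reachable.exists_walk_length_eq_dist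
  obtain ⟨q₂, hq₂⟩ := (w.drop i).reachable.exists_walk_length_eq_dist
  have h3 : H.dist x y ≤ (q₁.append q₂).length := SimpleGraph.dist_le _
  rw [SimpleGraph.Walk.length_append] at h3
  omega

/-- Connected vertices of a set of sites are the ends of an induced finite path in it. -/
lemma exists_induced_path {S : Set V} {x y : V} (hx : x ∈ S)
    (h : (openGraph G S).Reachable x y) :
    ∃ (n : ℕ) (p : ℕ → V), p 0 = x ∧ p n = y ∧ (∀ i ≤ n, p i ∈ S) ∧
      (∀ i ≤ n, ∀ j ≤ n, p i = p j → i = j) ∧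
      ∀ i ≤ n, ∀ j ≤ n, (G.Adj (p i) (p j) ↔ (j = i + 1 ∨ i = j + 1)) := by
  obtain ⟨n, p, h0, hn, hadj, hd⟩ := exists_geodesic h
  have hS : ∀ i ≤ n, p i ∈ S := fun i hi => mem_of_reachable_openGraph hx (hd i hi).1
  have key : ∀ i ≤ n, ∀ j ≤ n, G.Adj (p i) (p j) → j ≤ i + 1 := by
    intro i hi j hj hij
    have hij' : (openGraph G S).Adj (p i) (p j) := ⟨hij, hS i hi, hS j hj⟩
    obtain ⟨q, hq⟩ := (hd i hi).1.exists_walk_length_eq_dist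
    have := SimpleGraph.dist_le (q.concat hij')
    rw [SimpleGraph.Walk.length_concat, hq, (hd i hi).2, (hd j hj).2] at this
    exact this
  refine ⟨n, p, h0, hn, hS, ?_, ?_⟩
  · intro i hi j hj hij
    rw [← (hd i hi).2, ← (hd j hj).2, hij]
  · intro i hi j hj
    constructor
    · intro hij
      have h1 := key i hi j hj hij
      have h2 := key j hj i hi hij.symm
      have h3 : i ≠ j := by rintro rfl; exact hij.ne rfl
      omega
    · rintro (rfl | rfl)
      · exact (hadj i (by omega)).1
      · exact (hadj j (by omega)).1.symm

/-- An induced one-sided infinite path that avoids `D`, and of which only the first vertex may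
be adjacent to `D`. -/
structure IsExitRay (G : SimpleGraph V) (D : Set V) (ρ : ℕ → V) : Prop where
  adj_iff : ∀ i j, G.Adj (ρ i) (ρ j) ↔ (j = i + 1 ∨ i = j + 1)
  notMem : ∀ i, ρ i ∉ D
  not_adj : ∀ i, ∀ d ∈ D, ¬ G.Adj (ρ (i + 1)) d

/-- Two sequences of vertices with no common vertex and no edge between them. -/
def Separated (G : SimpleGraph V) (ρ η : ℕ → V) : Prop :=
  ∀ i j, ρ i ≠ η j ∧ ¬ G.Adj (ρ i) (η j)

lemma Separated.symm {ρ η : ℕ → V} (h : Separated G ρ η) : Separated G η ρ :=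
  fun i j => ⟨(h j i).1.symm, fun h' => (h j i).2 h'.symm⟩

lemma IsExitRay.eq_zero_of_adj {D : Set V} {ρ : ℕ → V} (h : IsExitRay G D ρ) {i : ℕ} {d : V}
    (hd : d ∈ D) (hadj : G.Adj (ρ i) d) : i = 0 := by
  cases i with
  | zero => rfl
  | succ i => exact absurd hadj (h.not_adj i d hd)

/-- A two-sided sequence whose only adjacencies are the consecutive ones is injective. -/
lemma injective_of_adj_iff {γ : ℤ → V}
    (h : ∀ i j : ℤ, G.Adj (γ i) (γ j) ↔ (j = i + 1 ∨ i = j + 1)) : Function.Injective γ := by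
  intro i j hij
  have h1 := (h (i - 1) i).2 (by omega)
  have h2 := (h (i + 1) i).2 (by omega)
  rw [hij, h] at h1 h2
  omega

end Graph

/-! ### Doubly-infinite paths along rays -/

section Paths

variable {L : Lattice}

lemma mem_cluster_iff {ω : Set (Site L)} {x y : Site L} :
    y ∈ cluster ω x ↔ x ∈ ω ∧ (openGraph (graph L) ω).Reachable x y := by
  constructor
  · rintro ⟨w, hw⟩
    refine ⟨hw x w.start_mem_support, ?_⟩
    induction w with
    | nil => exact SimpleGraph.Reachable.refl _
    | cons h w ih =>
      refine (SimpleGraph.Adj.reachable (G := openGraph _ ω)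
        ⟨h, hw _ (by simp), hw _ (by simp)⟩).trans (ih fun z hz => hw z ?_)
      rw [SimpleGraph.Walk.support_cons]
      exact List.mem_cons_of_mem _ hz
  · rintro ⟨hx, h⟩
    rw [SimpleGraph.reachable_iff_reflTransGen] at h
    induction h with
    | refl => exact ⟨SimpleGraph.Walk.nil, by simpa using hx⟩
    | tail _ h ih =>
      obtain ⟨w, hw⟩ := ih
      refine ⟨w.concat h.1, fun z hz => ?_⟩
      rw [SimpleGraph.Walk.support_concat, List.mem_append] at hz
      rcases hz with hz | hz
      · exact hw z hz
      · rw [List.mem_singleton.1 hz]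
        exact h.2.2

/-- Two separated rays leaving `D` whose starting points are connected through `D` can be joined
to a doubly-infinite self-repelling path. -/
lemma hasBiinfinite_of_reachable {D T : Set (Site L)} {ρ η : ℕ → Site L}
    (hρ : IsExitRay (graph L) D ρ) (hη : IsExitRay (graph L) D η)
    (hsep : Separated (graph L) ρ η) (hT : T ⊆ D)
    (h : (openGraph (graph L) (T ∪ {ρ 0, η 0})).Reachable (ρ 0) (η 0)) :
    HasBiinfiniteSelfRepellingPath (T ∪ range ρ ∪ range η) := by
  obtain ⟨n, p, h0, hn, hS, hinj, hadj⟩ := exists_induced_path (by simp) h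
  have hmid : ∀ i, 0 < i → i < n → p i ∈ T := by
    intro i h0i hin
    rcases hS i hin.le with h | h | h
    · exact h
    · have := hinj i hin.le 0 (by omega) (h.trans h0.symm)
      omega
    · have := hinj i hin.le n le_rfl (h.trans hn.symm)
      omega
  have hn0 : 0 < n := by
    rcases Nat.eq_zero_or_pos n with rfl | hn0
    · exact absurd (h0.symm.trans hn) (hsep 0 0).1
    · exact hn0
  have hρp : ∀ i j, j ≤ n → ((graph L).Adj (ρ (i + 1)) (p j) ↔ i = 0 ∧ j = 0) := by
    intro i j hj
    rcases Nat.eq_zero_or_pos j with rfl | hj0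
    · rw [h0, hρ.adj_iff]; omega
    · rcases hj.eq_or_lt with rfl | hjn
      · rw [hn]
        exact iff_of_false (hsep _ _).2 (by omega)
      · exact iff_of_false (hρ.not_adj i _ (hT (hmid j hj0 hjn))) (by omega)
  have hηp : ∀ i j, j ≤ n → ((graph L).Adj (η (i + 1)) (p j) ↔ i = 0 ∧ j = n) := by
    intro i j hj
    rcases hj.eq_or_lt with rfl | hjn
    · rw [hn, hη.adj_iff]; omega
    · rcases Nat.eq_zero_or_pos j with rfl | hj0
      · rw [h0]
        exact iff_of_false (hsep.symm _ _).2 (by omega)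
      · exact iff_of_false (hη.not_adj i _ (hT (hmid j hj0 hjn))) (by omega)
  -- the first ray backwards, the induced path, the second ray
  let γ : ℤ → Site L := fun i =>
    if i < 0 then ρ (-i).toNat else if i ≤ n then p i.toNat else η (i - n).toNat
  have hγ1 : ∀ i : ℕ, γ (-(i + 1 : ℕ)) = ρ (i + 1) := by
    intro i
    simp only [γ]
    rw [if_pos (by omega)]
    congr 1
  have hγ2 : ∀ i : ℕ, i ≤ n → γ i = p i := by
    intro i hi
    simp only [γ]
    rw [if_neg (by omega), if_pos (by omega)]
    congr 1
  have hγ3 : ∀ i : ℕ, γ ((n + (i + 1) : ℕ)) = η (i + 1) := by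
    intro i
    simp only [γ]
    rw [if_neg (by omega), if_neg (by omega)]
    congr 1
    omega
  have hcase : ∀ i : ℤ, (∃ k : ℕ, i = -(k + 1 : ℕ)) ∨ (∃ k : ℕ, k ≤ n ∧ i = k) ∨
      (∃ k : ℕ, i = (n + (k + 1) : ℕ)) := by
    intro i
    rcases lt_or_ge i 0 with h | h
    · exact Or.inl ⟨(-i).toNat - 1, by omega⟩
    · rcases le_or_gt i n with h' | h'
      · exact Or.inr (Or.inl ⟨i.toNat, by omega, by omega⟩)
      · exact Or.inr (Or.inr ⟨(i - n).toNat - 1, by omega⟩)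
  have hγ : ∀ i j : ℤ, (graph L).Adj (γ i) (γ j) ↔ (j = i + 1 ∨ i = j + 1) := by
    intro i j
    rcases hcase i with ⟨k, rfl⟩ | ⟨k, hk, rfl⟩ | ⟨k, rfl⟩ <;>
    rcases hcase j with ⟨l, rfl⟩ | ⟨l, hl, rfl⟩ | ⟨l, rfl⟩
    · rw [hγ1, hγ1, hρ.adj_iff]; omega
    · rw [hγ1, hγ2 l hl, hρp k l hl]; omega
    · rw [hγ1, hγ3]
      exact iff_of_false (hsep _ _).2 (by omega)
    · rw [hγ1, hγ2 k hk, SimpleGraph.adj_comm, hρp l k hk]; omega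
    · rw [hγ2 k hk, hγ2 l hl, hadj k hk l hl]; omega
    · rw [hγ2 k hk, hγ3, SimpleGraph.adj_comm, hηp l k hk]; omega
    · rw [hγ1, hγ3]
      exact iff_of_false (hsep.symm _ _).2 (by omega)
    · rw [hγ3, hγ2 l hl, hηp k l hl]; omega
    · rw [hγ3, hγ3, hη.adj_iff]; omega
  refine ⟨γ, injective_of_adj_iff hγ, fun i => ?_, hγ⟩
  rcases hcase i with ⟨k, rfl⟩ | ⟨k, hk, rfl⟩ | ⟨k, rfl⟩
  · rw [hγ1]; exact Or.inl (Or.inr ⟨_, rfl⟩)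
  · rw [hγ2 k hk]
    rcases hS k hk with h | h | h
    · exact Or.inl (Or.inl h)
    · rw [h]; exact Or.inl (Or.inr ⟨_, rfl⟩)
    · rw [h]; exact Or.inr ⟨_, rfl⟩
  · rw [hγ3]; exact Or.inr ⟨_, rfl⟩

/-- A one-sided infinite path of distinct sites in the union of a finite set and a ray runs
through all sites of the ray beyond its starting point. -/
lemma exists_eq_of_injective {D T : Set (Site L)} {ρ : ℕ → Site L}
    (hρ : IsExitRay (graph L) D ρ) (hT : T ⊆ D) (hfin : T.Finite) {γ : ℕ → Site L}
    (hγ : Function.Injective γ) (hmem : ∀ i, γ i ∈ T ∪ range ρ)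
    (hadj : ∀ i, (graph L).Adj (γ i) (γ (i + 1))) {m : ℕ}
    (h0 : γ 0 ∈ T ∪ ρ '' Iio m) (hm : 0 < m) : ∃ i, γ (i + 1) = ρ m := by
  by_contra! hne
  have key : ∀ i, γ i ∈ T ∪ ρ '' Iio m := by
    intro i
    induction i with
    | zero => exact h0
    | succ i ih =>
      rcases hmem (i + 1) with h | ⟨b, hb⟩
      · exact Or.inl h
      · refine Or.inr ⟨b, ?_, hb⟩
        have hbm : b ≠ m := by rintro rfl; exact hne i hb.symm
        have ha := hadj i
        rcases ih with h | ⟨a, ha', h⟩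
        · rw [← hb] at ha
          have := hρ.eq_zero_of_adj (hT h) ha.symm
          simp only [mem_Iio]; omega
        · rw [← hb, ← h, hρ.adj_iff] at ha
          simp only [mem_Iio] at ha' ⊢; omega
  exact infinite_range_of_injective hγ
    ((hfin.union ((finite_Iio m).image ρ)).subset (range_subset_iff.2 key))

/-- Both ends of a doubly-infinite path in the union of a finite set and a ray would run along
the ray. -/
lemma not_hasBiinfinite_union_ray {D T : Set (Site L)} {ρ : ℕ → Site L}
    (hρ : IsExitRay (graph L) D ρ) (hT : T ⊆ D) (hfin : T.Finite) :
    ¬ HasBiinfiniteSelfRepellingPath (T ∪ range ρ) := by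
  rintro ⟨γ, hinj, hmem, hadj⟩
  obtain ⟨m, hm, h0⟩ : ∃ m, 0 < m ∧ γ 0 ∈ T ∪ ρ '' Iio m := by
    rcases hmem 0 with h | ⟨i, hi⟩
    · exact ⟨1, one_pos, Or.inl h⟩
    · exact ⟨i + 1, by omega, Or.inr ⟨i, by simp, hi⟩⟩
  obtain ⟨i, hi⟩ := exists_eq_of_injective hρ hT hfin (γ := fun i : ℕ => γ i)
    (fun a b h => by have := hinj h; omega) (fun i => hmem _) (fun i => by rw [hadj]; omega) h0 hm
  obtain ⟨j, hj⟩ := exists_eq_of_injective hρ hT hfin (γ := fun i : ℕ => γ (-i))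
    (fun a b h => by have := hinj h; omega) (fun i => hmem _) (fun i => by rw [hadj]; omega)
    (by simpa using h0) hm
  have := hinj (hi.trans hj.symm)
  omega

/-- A doubly-infinite self-repelling path in the union of a finite set and two separated rays
uses both rays, so that it connects them through the finite set. -/
lemma reachable_of_hasBiinfinite {D T : Set (Site L)} {ρ η : ℕ → Site L}
    (hρ : IsExitRay (graph L) D ρ) (hη : IsExitRay (graph L) D η)
    (hsep : Separated (graph L) ρ η) (hT : T ⊆ D) (hfin : T.Finite)
    (h : HasBiinfiniteSelfRepellingPath (T ∪ range ρ ∪ range η)) :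
    (openGraph (graph L) (T ∪ {ρ 0, η 0})).Reachable (ρ 0) (η 0) := by
  by_contra hcon
  obtain ⟨γ, hinj, hmem, hadj⟩ := h
  set S := T ∪ {ρ 0, η 0} with hS
  set P : Set (Site L) := {v | (openGraph (graph L) S).Reachable (ρ 0) v} ∪ range ρ with hP
  -- no edge joins a site of `P` to another site of the configuration
  have hclosed : ∀ v ∈ T ∪ range ρ ∪ range η, ∀ w ∈ T ∪ range ρ ∪ range η,
      (graph L).Adj v w → v ∈ P → w ∈ P := by
    rintro v - w hw hvw (hv | ⟨i, rfl⟩)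
    · rcases mem_of_reachable_openGraph (by simp [hS]) hv with hvT | hv0
      · rcases hw with (hw | ⟨j, rfl⟩) | ⟨j, rfl⟩
        · exact Or.inl (hv.trans (SimpleGraph.Adj.reachable ⟨hvw, Or.inl hvT, Or.inl hw⟩))
        · exact Or.inr ⟨j, rfl⟩
        · obtain rfl := hη.eq_zero_of_adj (hT hvT) hvw.symm
          exact absurd (hv.trans
            (SimpleGraph.Adj.reachable ⟨hvw, Or.inl hvT, by simp [hS]⟩)) hcon
      · rcases hv0 with rfl | rfl
        · rcases hw with (hw | ⟨j, rfl⟩) | ⟨j, rfl⟩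
          · exact Or.inl (SimpleGraph.Adj.reachable ⟨hvw, by simp [hS], Or.inl hw⟩)
          · exact Or.inr ⟨j, rfl⟩
          · exact absurd hvw (hsep _ _).2
        · exact absurd hv hcon
    · rcases hw with (hw | ⟨j, rfl⟩) | ⟨j, rfl⟩
      · obtain rfl := hρ.eq_zero_of_adj (hT hw) hvw
        exact Or.inl (SimpleGraph.Adj.reachable ⟨hvw, by simp [hS], Or.inl hw⟩)
      · exact Or.inr ⟨j, rfl⟩
      · exact absurd hvw (hsep _ _).2
  have hstep : ∀ i : ℤ, γ i ∈ P ↔ γ (i + 1) ∈ P := fun i =>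
    ⟨hclosed _ (hmem _) _ (hmem _) ((hadj _ _).2 (by omega)),
      hclosed _ (hmem _) _ (hmem _) ((hadj _ _).2 (by omega))⟩
  have hall : ∀ i : ℤ, γ i ∈ P ↔ γ 0 ∈ P := by
    intro i
    induction i using Int.induction_on with
    | zero => rfl
    | succ i ih => rw [← hstep, ih]
    | pred i ih => rw [hstep, ← ih]; simp
  by_cases h0 : γ 0 ∈ P
  · refine not_hasBiinfinite_union_ray hρ hT hfin ⟨γ, hinj, fun i => ?_, hadj⟩
    rcases (hall i).2 h0 with h | h
    · rcases mem_of_reachable_openGraph (by simp [hS]) h with h' | h' | h'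
      · exact Or.inl h'
      · rw [h']; exact Or.inr ⟨0, rfl⟩
      · rw [mem_singleton_iff.1 h'] at h
        exact absurd h hcon
    · exact Or.inr h
  · refine not_hasBiinfinite_union_ray hη hT hfin ⟨γ, hinj, fun i => ?_, hadj⟩
    rcases hmem i with (h | h) | h
    · exact Or.inl h
    · exact absurd ((hall i).1 (Or.inr h)) h0
    · exact Or.inr h

/-- A finite set of sites `D` such that any two distinct nonadjacent sites on its outer boundary
are the starting points of separated rays leaving `D`. -/
structure HasExitRays (D : Set (Site L)) : Prop where
  finite : D.Finite
  exists_rays : ∀ x ∉ D, ∀ y ∉ D, x ≠ y → ¬ (graph L).Adj x y →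
    (∃ d ∈ D, (graph L).Adj x d) → (∃ d ∈ D, (graph L).Adj y d) →
    ∃ ρ η : ℕ → Site L, ρ 0 = x ∧ η 0 = y ∧ IsExitRay (graph L) D ρ ∧
      IsExitRay (graph L) D η ∧ Separated (graph L) ρ η

/-- If adding `E ⊆ D` never creates a doubly-infinite self-repelling path, then it does not
connect two sites on the outer boundary of `D` through `D`. -/
lemma reachable_of_reachable_through {D E ω : Set (Site L)} (hD : HasExitRays D) (hE : E ⊆ D)
    (hcreate : ∀ ω' : Set (Site L), ω' ∩ D = ω ∩ D → ¬ HasBiinfiniteSelfRepellingPath ω' →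
      ¬ HasBiinfiniteSelfRepellingPath (ω' ∪ E))
    {x y : Site L} (hx : x ∈ ω) (hy : y ∈ ω) (hxD : x ∉ D) (hyD : y ∉ D)
    (hxd : ∃ d ∈ D, (graph L).Adj x d) (hyd : ∃ d ∈ D, (graph L).Adj y d)
    (h : (openGraph (graph L) ((ω ∪ E) ∩ D ∪ {x, y})).Reachable x y) :
    (openGraph (graph L) ω).Reachable x y := by
  rcases eq_or_ne x y with rfl | hxy
  · exact SimpleGraph.Reachable.refl _
  by_cases hadj : (graph L).Adj x y
  · exact SimpleGraph.Adj.reachable ⟨hadj, hx, hy⟩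
  obtain ⟨ρ, η, rfl, rfl, hρ, hη, hsep⟩ := hD.exists_rays x hxD y hyD hxy hadj hxd hyd
  have hBi := hasBiinfinite_of_reachable hρ hη hsep inter_subset_right h
  have hω' : (ω ∩ D ∪ range ρ ∪ range η) ∩ D = ω ∩ D := by
    ext v
    constructor
    · rintro ⟨(h | ⟨i, rfl⟩) | ⟨i, rfl⟩, hv⟩
      · exact h
      · exact absurd hv (hρ.notMem i)
      · exact absurd hv (hη.notMem i)
    · exact fun h => ⟨Or.inl (Or.inl h), h.2⟩
  have heq : (ω ∪ E) ∩ D ∪ range ρ ∪ range η = (ω ∩ D ∪ range ρ ∪ range η) ∪ E := by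
    rw [union_inter_distrib_right, inter_eq_left.2 hE]
    ext v
    simp only [mem_union]
    tauto
  rw [heq] at hBi
  have hBi' : HasBiinfiniteSelfRepellingPath (ω ∩ D ∪ range ρ ∪ range η) := by
    by_contra hno
    exact hcreate _ hω' hno hBi
  refine (reachable_of_hasBiinfinite hρ hη hsep inter_subset_right
    (hD.finite.subset inter_subset_right) hBi').mono (openGraph_mono ?_)
  rintro v (h | rfl | rfl)
  exacts [h.1, hx, hy]

/-- If adding `E ⊆ D` never creates a doubly-infinite self-repelling path, then it does not
connect sites outside `D`: each excursion of a path into `D` can be replaced. -/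
lemma reachable_of_reachable_union {D E ω : Set (Site L)} (hD : HasExitRays D) (hE : E ⊆ D)
    (hcreate : ∀ ω' : Set (Site L), ω' ∩ D = ω ∩ D → ¬ HasBiinfiniteSelfRepellingPath ω' →
      ¬ HasBiinfiniteSelfRepellingPath (ω' ∪ E))
    {u v : Site L} (hu : u ∉ D) (hv : v ∉ D)
    (h : (openGraph (graph L) (ω ∪ E)).Reachable u v) :
    (openGraph (graph L) ω).Reachable u v := by
  have hout : ∀ w ∈ ω ∪ E, w ∉ D → w ∈ ω := fun w hw hwD =>
    hw.resolve_right fun h => hwD (hE h)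
  -- inside `D`, the walk remembers the site `x` from which it last entered `D`
  have key : (v ∉ D → (openGraph (graph L) ω).Reachable u v) ∧
      (v ∈ D → ∃ x ∈ ω, x ∉ D ∧ (∃ d ∈ D, (graph L).Adj x d) ∧
        (openGraph (graph L) ω).Reachable u x ∧
        (openGraph (graph L) ((ω ∪ E) ∩ D ∪ {x})).Reachable x v) := by
    clear hv
    rw [SimpleGraph.reachable_iff_reflTransGen] at h
    induction h with
    | refl => exact ⟨fun _ => SimpleGraph.Reachable.refl _, fun h => absurd h hu⟩
    | @tail w w' _ hww' ih =>
      obtain ⟨hadj, hw, hw'⟩ := hww'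
      by_cases hwD : w ∈ D
      · obtain ⟨x, hxω, hxD, hxd, hux, hxw⟩ := ih.2 hwD
        constructor
        · intro hwD'
          refine hux.trans (reachable_of_reachable_through hD hE hcreate hxω (hout _ hw' hwD')
            hxD hwD' hxd ⟨w, hwD, hadj.symm⟩ ?_)
          refine (hxw.mono (openGraph_mono ?_)).trans
            (SimpleGraph.Adj.reachable ⟨hadj, Or.inl ⟨hw, hwD⟩, by simp⟩)
          exact union_subset_union_right _ (by simp)
        · intro hwD'
          exact ⟨x, hxω, hxD, hxd, hux, hxw.trans
            (SimpleGraph.Adj.reachable ⟨hadj, Or.inl ⟨hw, hwD⟩, Or.inl ⟨hw', hwD'⟩⟩)⟩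
      · have huw := ih.1 hwD
        constructor
        · intro hwD'
          exact huw.trans
            (SimpleGraph.Adj.reachable ⟨hadj, hout _ hw hwD, hout _ hw' hwD'⟩)
        · intro hwD'
          exact ⟨w, hout _ hw hwD, hwD, ⟨w', hwD', hadj⟩, huw,
            SimpleGraph.Adj.reachable ⟨hadj, by simp, Or.inl ⟨hw', hwD'⟩⟩⟩
  exact key.1 hv

end Paths

/-! ### Adjacency in lattice coordinates -/

lemma sq_dist_pos {L : Lattice} (x y : Site L) :
    dist (pos x) (pos y) ^ 2 = (pos x 0 - pos y 0) ^ 2 + (pos x 1 - pos y 1) ^ 2 := by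
  rw [EuclideanSpace.dist_eq, Real.sq_sqrt (by positivity)]
  simp [Fin.sum_univ_two, Real.dist_eq, sq_abs]

lemma adj_iff_sq {L : Lattice} (x y : Site L) :
    (graph L).Adj x y ↔ (pos x 0 - pos y 0) ^ 2 + (pos x 1 - pos y 1) ^ 2 = 1 := by
  rw [← sq_dist_pos, pow_eq_one_iff_of_nonneg dist_nonneg two_ne_zero]
  rfl

lemma class_square (x : Site .square) : x.2 = 0 := Fin.ext (by
  have := x.2.isLt; simp only [Lattice.numClasses] at this; simp only [Fin.val_zero]; omega)

lemma class_triangular (x : Site .triangular) : x.2 = 0 := Fin.ext (by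
  have := x.2.isLt; simp only [Lattice.numClasses] at this; simp only [Fin.val_zero]; omega)

lemma pos_square (x : Site .square) : pos x 0 = x.1.1 ∧ pos x 1 = x.1.2 := by
  simp [pos, Lattice.e₁, Lattice.e₂, class_square x]

lemma pos_triangular (x : Site .triangular) :
    pos x 0 = x.1.1 + x.1.2 / 2 ∧ pos x 1 = x.1.2 * (√3 / 2) := by
  simp [pos, Lattice.e₁, Lattice.e₂, class_triangular x]
  ring

lemma pos_hexagonal (x : Site .hexagonal) :
    pos x 0 = 3 / 2 * (x.1.1 + x.1.2) + (x.2 : ℕ) ∧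
      pos x 1 = (x.1.1 - x.1.2) * (√3 / 2) := by
  simp [pos, Lattice.e₁, Lattice.e₂]
  constructor <;> ring

lemma adj_square (x y : Site .square) : (graph .square).Adj x y ↔
    (x.1.1 = y.1.1 ∧ (x.1.2 = y.1.2 + 1 ∨ y.1.2 = x.1.2 + 1)) ∨
    (x.1.2 = y.1.2 ∧ (x.1.1 = y.1.1 + 1 ∨ y.1.1 = x.1.1 + 1)) := by
  obtain ⟨⟨a, b⟩, k⟩ := x
  obtain ⟨⟨c, d⟩, l⟩ := y
  rw [adj_iff_sq, (pos_square _).1, (pos_square _).2, (pos_square _).1, (pos_square _).2]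
  dsimp only
  have h0 : ((a : ℝ) - c) ^ 2 + (b - d) ^ 2 = 1 ↔ (a - c) ^ 2 + (b - d) ^ 2 = 1 := by
    exact_mod_cast Iff.rfl
  obtain ⟨u, rfl⟩ : ∃ u, a = c + u := ⟨a - c, by ring⟩
  obtain ⟨v, rfl⟩ : ∃ v, b = d + v := ⟨b - d, by ring⟩
  rw [h0, add_sub_cancel_left, add_sub_cancel_left]
  constructor
  · intro h
    have h1 : -1 ≤ u := by nlinarith [sq_nonneg v]
    have h2 : u ≤ 1 := by nlinarith [sq_nonneg v]
    have h3 : -1 ≤ v := by nlinarith [sq_nonneg u]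
    have h4 : v ≤ 1 := by nlinarith [sq_nonneg u]
    interval_cases u <;> interval_cases v <;> omega
  · intro h
    have : (u = 0 ∧ (v = 1 ∨ v = -1)) ∨ (v = 0 ∧ (u = 1 ∨ u = -1)) := by omega
    rcases this with ⟨rfl, rfl | rfl⟩ | ⟨rfl, rfl | rfl⟩ <;> norm_num

lemma adj_triangular (x y : Site .triangular) : (graph .triangular).Adj x y ↔
    (x.1.1 = y.1.1 ∧ (x.1.2 = y.1.2 + 1 ∨ y.1.2 = x.1.2 + 1)) ∨
    (x.1.2 = y.1.2 ∧ (x.1.1 = y.1.1 + 1 ∨ y.1.1 = x.1.1 + 1)) ∨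
    (x.1.1 + x.1.2 = y.1.1 + y.1.2 ∧ (x.1.1 = y.1.1 + 1 ∨ y.1.1 = x.1.1 + 1)) := by
  obtain ⟨⟨a, b⟩, k⟩ := x
  obtain ⟨⟨c, d⟩, l⟩ := y
  rw [adj_iff_sq, (pos_triangular _).1, (pos_triangular _).2, (pos_triangular _).1,
    (pos_triangular _).2]
  dsimp only
  obtain ⟨u, rfl⟩ : ∃ u, a = c + u := ⟨a - c, by ring⟩
  obtain ⟨v, rfl⟩ : ∃ v, b = d + v := ⟨b - d, by ring⟩
  have h3 : (√3 : ℝ) ^ 2 = 3 := Real.sq_sqrt (by norm_num)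
  have h0 : ((((c + u : ℤ) : ℝ) + ((d + v : ℤ) : ℝ) / 2) - (c + d / 2)) ^ 2 +
      (((d + v : ℤ) : ℝ) * (√3 / 2) - d * (√3 / 2)) ^ 2 = ((u ^ 2 + u * v + v ^ 2 : ℤ) : ℝ) := by
    push_cast
    linear_combination (v : ℝ) ^ 2 / 4 * h3
  rw [h0, Int.cast_eq_one]
  constructor
  · intro h
    have h1 : -1 ≤ u := by nlinarith [sq_nonneg (u + 2 * v)]
    have h2 : u ≤ 1 := by nlinarith [sq_nonneg (u + 2 * v)]
    have h3 : -1 ≤ v := by nlinarith [sq_nonneg (2 * u + v)]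
    have h4 : v ≤ 1 := by nlinarith [sq_nonneg (2 * u + v)]
    interval_cases u <;> interval_cases v <;> omega
  · intro h
    have : (u = 0 ∧ (v = 1 ∨ v = -1)) ∨ (v = 0 ∧ (u = 1 ∨ u = -1)) ∨
      (u = 1 ∧ v = -1) ∨ (u = -1 ∧ v = 1) := by omega
    rcases this with ⟨rfl, rfl | rfl⟩ | ⟨rfl, rfl | rfl⟩ | ⟨rfl, rfl⟩ | ⟨rfl, rfl⟩ <;> norm_num

/-- In the hexagonal lattice, adjacent sites have different classes. -/
lemma adj_hexagonal (x y : Site .hexagonal) : (graph .hexagonal).Adj x y ↔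
    ((x.2 : ℕ) = 0 ∧ (y.2 : ℕ) = 1 ∧ ((x.1.1 = y.1.1 ∧ (x.1.2 = y.1.2 ∨ x.1.2 = y.1.2 + 1)) ∨
      (x.1.1 = y.1.1 + 1 ∧ x.1.2 = y.1.2))) ∨
    ((x.2 : ℕ) = 1 ∧ (y.2 : ℕ) = 0 ∧ ((x.1.1 = y.1.1 ∧ (x.1.2 = y.1.2 ∨ y.1.2 = x.1.2 + 1)) ∨
      (y.1.1 = x.1.1 + 1 ∧ x.1.2 = y.1.2))) := by
  obtain ⟨⟨a, b⟩, k⟩ := x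
  obtain ⟨⟨c, d⟩, l⟩ := y
  rw [adj_iff_sq, (pos_hexagonal _).1, (pos_hexagonal _).2, (pos_hexagonal _).1,
    (pos_hexagonal _).2]
  dsimp only
  have hk : (k : ℕ) < 2 := k.isLt
  have hl : (l : ℕ) < 2 := l.isLt
  generalize (k : ℕ) = k' at *
  generalize (l : ℕ) = l' at *
  obtain ⟨u, rfl⟩ : ∃ u, a = c + u := ⟨a - c, by ring⟩
  obtain ⟨v, rfl⟩ : ∃ v, b = d + v := ⟨b - d, by ring⟩
  have h3 : (√3 : ℝ) ^ 2 = 3 := Real.sq_sqrt (by norm_num)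
  have h0 : (3 / 2 * (((c + u : ℤ) : ℝ) + ((d + v : ℤ) : ℝ)) + (k' : ℝ) -
      (3 / 2 * ((c : ℝ) + d) + (l' : ℝ))) ^ 2 +
      ((((c + u : ℤ) : ℝ) - ((d + v : ℤ) : ℝ)) * (√3 / 2) - ((c : ℝ) - d) * (√3 / 2)) ^ 2 =
      (((3 * (u + v) + 2 * ((k' : ℤ) - l')) ^ 2 + 3 * (u - v) ^ 2 : ℤ) : ℝ) / 4 := by
    push_cast
    linear_combination ((u : ℝ) - v) ^ 2 / 4 * h3
  rw [h0, div_eq_one_iff_eq (by norm_num), show (4 : ℝ) = ((4 : ℤ) : ℝ) by norm_num,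
    Int.cast_inj]
  constructor
  · intro h
    have h1 : -1 ≤ u - v := by nlinarith [sq_nonneg (3 * (u + v) + 2 * ((k' : ℤ) - l'))]
    have h2 : u - v ≤ 1 := by nlinarith [sq_nonneg (3 * (u + v) + 2 * ((k' : ℤ) - l'))]
    have h3 : -2 ≤ 3 * (u + v) + 2 * ((k' : ℤ) - l') := by nlinarith [sq_nonneg (u - v)]
    have h4 : 3 * (u + v) + 2 * ((k' : ℤ) - l') ≤ 2 := by nlinarith [sq_nonneg (u - v)]
    have hu : -1 ≤ u ∧ u ≤ 1 := by omega
    have hv : -1 ≤ v ∧ v ≤ 1 := by omega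
    obtain ⟨hu1, hu2⟩ := hu
    obtain ⟨hv1, hv2⟩ := hv
    interval_cases k' <;> interval_cases l' <;> interval_cases u <;> interval_cases v <;>
      norm_num at h <;> omega
  · intro h
    have : (k' = 0 ∧ l' = 1 ∧ (u = 0 ∧ v = 0 ∨ u = 0 ∧ v = 1 ∨ u = 1 ∧ v = 0)) ∨
      (k' = 1 ∧ l' = 0 ∧ (u = 0 ∧ v = 0 ∨ u = 0 ∧ v = -1 ∨ u = -1 ∧ v = 0)) := by omega
    rcases this with ⟨rfl, rfl, ⟨rfl, rfl⟩ | ⟨rfl, rfl⟩ | ⟨rfl, rfl⟩⟩ |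
      ⟨rfl, rfl, ⟨rfl, rfl⟩ | ⟨rfl, rfl⟩ | ⟨rfl, rfl⟩⟩ <;> norm_num

/-! ### Boxes and the rays leaving them -/

/-- The parallelogram of sites whose cell coordinates differ by at most `N` from those of `z`. -/
def box {L : Lattice} (z : ℤ × ℤ) (N : ℤ) : Set (Site L) :=
  {y | (z.1 - N ≤ y.1.1 ∧ y.1.1 ≤ z.1 + N) ∧ z.2 - N ≤ y.1.2 ∧ y.1.2 ≤ z.2 + N}

lemma finite_box {L : Lattice} (z : ℤ × ℤ) (N : ℤ) : (box z N : Set (Site L)).Finite := by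
  refine (((finite_Icc (z.1 - N) (z.1 + N)).prod (finite_Icc (z.2 - N) (z.2 + N))).prod
    (finite_univ (α := Fin L.numClasses))).subset ?_
  rintro y hy
  exact ⟨hy, mem_univ _⟩

/-- The site `x` lies just outside the box of centre `z` and radius `N`, which is left from `x` in
the direction `d`. Two of the four corners are assigned to the horizontal directions; the other
two are not adjacent to the box in any of the lattices. -/
def IsExit {L : Lattice} (z : ℤ × ℤ) (N : ℤ) (x : Site L) (d : ℤ × ℤ) : Prop :=
  (d = (1, 0) ∧ x.1.1 = z.1 + N + 1 ∧ z.2 - N - 1 ≤ x.1.2 ∧ x.1.2 ≤ z.2 + N) ∨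
  (d = (-1, 0) ∧ x.1.1 = z.1 - N - 1 ∧ z.2 - N ≤ x.1.2 ∧ x.1.2 ≤ z.2 + N + 1) ∨
  (d = (0, 1) ∧ x.1.2 = z.2 + N + 1 ∧ z.1 - N ≤ x.1.1 ∧ x.1.1 ≤ z.1 + N) ∨
  (d = (0, -1) ∧ x.1.2 = z.2 - N - 1 ∧ z.1 - N ≤ x.1.1 ∧ x.1.1 ≤ z.1 + N)

/-- The straight ray from `x` in the direction `d`. -/
def straightRay {L : Lattice} (x : Site L) (d : ℤ × ℤ) (n : ℕ) : Site L :=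
  ((x.1.1 + d.1 * n, x.1.2 + d.2 * n), x.2)

lemma straightRay_zero {L : Lattice} (x : Site L) (d : ℤ × ℤ) : straightRay x d 0 = x := by
  simp [straightRay]

lemma hasExitRays_square (z : ℤ × ℤ) (N : ℤ) :
    HasExitRays (box z N : Set (Site .square)) := by
  have hexit : ∀ x : Site .square, x ∉ box z N → (∃ y ∈ box z N, (graph .square).Adj x y) →
      ∃ d, IsExit z N x d := by
    rintro ⟨⟨a, b⟩, k⟩ hx ⟨⟨⟨a', b'⟩, k'⟩, hy, hxy⟩
    rw [adj_square] at hxy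
    simp only [box, mem_ofPred_eq] at hx hy hxy
    simp only [IsExit, exists_or, exists_eq_left]
    omega
  have hray : ∀ (x : Site .square) d, IsExit z N x d →
      IsExitRay (graph .square) (box z N) (straightRay x d) := by
    rintro ⟨⟨a, b⟩, k⟩ d (⟨rfl, h⟩ | ⟨rfl, h⟩ | ⟨rfl, h⟩ | ⟨rfl, h⟩) <;>
    · refine ⟨fun i j => ?_, fun i hi => ?_, ?_⟩
      · rw [adj_square]
        simp only [straightRay] at h ⊢
        omega
      · simp only [box, straightRay, mem_ofPred_eq] at h hi
        omega
      · rintro i ⟨⟨a', b'⟩, k'⟩ hy hadj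
        rw [adj_square] at hadj
        simp only [box, straightRay, mem_ofPred_eq] at h hy hadj
        push_cast at hadj
        omega
  refine ⟨finite_box z N, fun x hx y hy hxy hadj hxd hyd => ?_⟩
  obtain ⟨d, hd⟩ := hexit x hx hxd
  obtain ⟨e, he⟩ := hexit y hy hyd
  refine ⟨straightRay x d, straightRay y e, straightRay_zero x d, straightRay_zero y e,
    hray x d hd, hray y e he, fun i j => ?_⟩
  have hk : x.2 = y.2 := (class_square x).trans (class_square y).symm
  rw [adj_square]
  rw [adj_square] at hadj
  obtain ⟨⟨a, b⟩, k⟩ := x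
  obtain ⟨⟨a', b'⟩, k'⟩ := y
  obtain rfl : k = k' := hk
  simp only [ne_eq, Prod.ext_iff, straightRay, and_true] at hxy hadj ⊢
  rcases hd with ⟨rfl, h⟩ | ⟨rfl, h⟩ | ⟨rfl, h⟩ | ⟨rfl, h⟩ <;>
  rcases he with ⟨rfl, h'⟩ | ⟨rfl, h'⟩ | ⟨rfl, h'⟩ | ⟨rfl, h'⟩ <;>
  · simp only at h h' ⊢
    omega

lemma hasExitRays_triangular (z : ℤ × ℤ) (N : ℤ) :
    HasExitRays (box z N : Set (Site .triangular)) := by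
  have hexit : ∀ x : Site .triangular, x ∉ box z N →
      (∃ y ∈ box z N, (graph .triangular).Adj x y) → ∃ d, IsExit z N x d := by
    rintro ⟨⟨a, b⟩, k⟩ hx ⟨⟨⟨a', b'⟩, k'⟩, hy, hxy⟩
    rw [adj_triangular] at hxy
    simp only [box, mem_ofPred_eq] at hx hy hxy
    simp only [IsExit, exists_or, exists_eq_left]
    omega
  have hray : ∀ (x : Site .triangular) d, IsExit z N x d →
      IsExitRay (graph .triangular) (box z N) (straightRay x d) := by
    rintro ⟨⟨a, b⟩, k⟩ d (⟨rfl, h⟩ | ⟨rfl, h⟩ | ⟨rfl, h⟩ | ⟨rfl, h⟩) <;>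
    · refine ⟨fun i j => ?_, fun i hi => ?_, ?_⟩
      · rw [adj_triangular]
        simp only [straightRay] at h ⊢
        omega
      · simp only [box, straightRay, mem_ofPred_eq] at h hi
        omega
      · rintro i ⟨⟨a', b'⟩, k'⟩ hy hadj
        rw [adj_triangular] at hadj
        simp only [box, straightRay, mem_ofPred_eq] at h hy hadj
        push_cast at hadj
        omega
  refine ⟨finite_box z N, fun x hx y hy hxy hadj hxd hyd => ?_⟩
  obtain ⟨d, hd⟩ := hexit x hx hxd
  obtain ⟨e, he⟩ := hexit y hy hyd
  refine ⟨straightRay x d, straightRay y e, straightRay_zero x d, straightRay_zero y e,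
    hray x d hd, hray y e he, fun i j => ?_⟩
  have hk : x.2 = y.2 := (class_triangular x).trans (class_triangular y).symm
  rw [adj_triangular]
  rw [adj_triangular] at hadj
  obtain ⟨⟨a, b⟩, k⟩ := x
  obtain ⟨⟨a', b'⟩, k'⟩ := y
  obtain rfl : k = k' := hk
  simp only [ne_eq, Prod.ext_iff, straightRay, and_true] at hxy hadj ⊢
  rcases hd with ⟨rfl, h⟩ | ⟨rfl, h⟩ | ⟨rfl, h⟩ | ⟨rfl, h⟩ <;>
  rcases he with ⟨rfl, h'⟩ | ⟨rfl, h'⟩ | ⟨rfl, h'⟩ | ⟨rfl, h'⟩ <;>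
  · simp only at h h' ⊢
    omega

/-- On the hexagonal lattice, the ray that starts at `x`, moves to the zigzag line through `x`
(`e = 0`) or to a neighbouring line (`e ≠ 0`) and follows this line in the direction `d`. -/
def zigzagRay (x : Site .hexagonal) (d e : ℤ × ℤ) (n : ℕ) : Site .hexagonal :=
  ((x.1.1 + d.1 * (n / 2 : ℕ) + e.1 * (min n 1 : ℕ),
    x.1.2 + d.2 * (n / 2 : ℕ) + e.2 * (min n 1 : ℕ)),
    ⟨((x.2 : ℕ) + n) % 2, Nat.mod_lt _ two_pos⟩)

lemma zigzagRay_zero (x : Site .hexagonal) (d e : ℤ × ℤ) : zigzagRay x d e 0 = x := by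
  have : (x.2 : ℕ) < 2 := x.2.isLt
  obtain ⟨⟨a, b⟩, k⟩ := x
  simp only [zigzagRay, Prod.ext_iff, Fin.ext_iff]
  simp only at this
  refine ⟨⟨?_, ?_⟩, ?_⟩ <;> simp
  omega

/-- The site `x` of the hexagonal lattice lies just outside the box of centre `z` and radius `N`,
which is left from `x` in the direction `d`. -/
def IsHexExit (z : ℤ × ℤ) (N : ℤ) (x : Site .hexagonal) (d : ℤ × ℤ) : Prop :=
  (d = (1, 0) ∧ (x.2 : ℕ) = 0 ∧ x.1.1 = z.1 + N + 1 ∧ z.2 - N ≤ x.1.2 ∧ x.1.2 ≤ z.2 + N) ∨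
  (d = (-1, 0) ∧ (x.2 : ℕ) = 1 ∧ x.1.1 = z.1 - N - 1 ∧ z.2 - N ≤ x.1.2 ∧ x.1.2 ≤ z.2 + N) ∨
  (d = (0, 1) ∧ (x.2 : ℕ) = 0 ∧ x.1.2 = z.2 + N + 1 ∧ z.1 - N ≤ x.1.1 ∧ x.1.1 ≤ z.1 + N) ∨
  (d = (0, -1) ∧ (x.2 : ℕ) = 1 ∧ x.1.2 = z.2 - N - 1 ∧ z.1 - N ≤ x.1.1 ∧ x.1.1 ≤ z.1 + N)

set_option maxHeartbeats 1000000 in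
lemma isExitRay_zigzagRay {z : ℤ × ℤ} {N : ℤ} {x : Site .hexagonal} {d : ℤ × ℤ}
    (hd : IsHexExit z N x d) {e : ℤ × ℤ} (he : e = (0, 0) ∨ e = (-d.2, -d.1)) :
    IsExitRay (graph .hexagonal) (box z N) (zigzagRay x d e) := by
  obtain ⟨⟨a, b⟩, k⟩ := x
  rcases hd with ⟨rfl, h⟩ | ⟨rfl, h⟩ | ⟨rfl, h⟩ | ⟨rfl, h⟩ <;> rcases he with rfl | rfl <;>
  · refine ⟨fun i j => ?_, fun i hi => ?_, ?_⟩
    · rw [adj_hexagonal]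
      simp only [zigzagRay] at h ⊢
      omega
    · simp only [box, zigzagRay, mem_ofPred_eq] at h hi
      omega
    · rintro i ⟨⟨a', b'⟩, k'⟩ hy hadj
      rw [adj_hexagonal] at hadj
      simp only [box, zigzagRay, mem_ofPred_eq] at h hy hadj
      omega

/-- Rays leaving different sides of the box can follow the lines of their starting points. -/
lemma separated_zigzagRay_of_ne {z : ℤ × ℤ} {N : ℤ} {x y : Site .hexagonal} {d d' : ℤ × ℤ}
    (hd : IsHexExit z N x d) (hd' : IsHexExit z N y d') (hne : d ≠ d') :
    Separated (graph .hexagonal) (zigzagRay x d (0, 0)) (zigzagRay y d' (0, 0)) := by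
  intro i j
  rw [adj_hexagonal]
  obtain ⟨⟨a, b⟩, k⟩ := x
  obtain ⟨⟨a', b'⟩, k'⟩ := y
  simp only [ne_eq, Prod.ext_iff, zigzagRay, Fin.ext_iff]
  rcases hd with ⟨rfl, h⟩ | ⟨rfl, h⟩ | ⟨rfl, h⟩ | ⟨rfl, h⟩ <;>
  rcases hd' with ⟨rfl, h'⟩ | ⟨rfl, h'⟩ | ⟨rfl, h'⟩ | ⟨rfl, h'⟩ <;>
  first
  | exact absurd rfl hne
  | simp only at h h' ⊢
    omega

/-- Neighbouring zigzag lines are adjacent; so of two rays that leave the same side of the box,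
one is moved to the next line away from the other one. -/
lemma separated_zigzagRay_of_lt {z : ℤ × ℤ} {N : ℤ} {x y : Site .hexagonal} {d : ℤ × ℤ}
    (hd : IsHexExit z N x d) (hd' : IsHexExit z N y d)
    (hlt : d.1 * (y.1.2 - x.1.2) + d.2 * (y.1.1 - x.1.1) < 0) :
    Separated (graph .hexagonal) (zigzagRay x d (0, 0)) (zigzagRay y d (-d.2, -d.1)) := by
  intro i j
  rw [adj_hexagonal]
  obtain ⟨⟨a, b⟩, k⟩ := x
  obtain ⟨⟨a', b'⟩, k'⟩ := y
  simp only [ne_eq, Prod.ext_iff, zigzagRay, Fin.ext_iff]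
  rcases hd with ⟨rfl, h⟩ | ⟨rfl, h⟩ | ⟨rfl, h⟩ | ⟨rfl, h⟩ <;>
  rcases hd' with ⟨hd', h'⟩ | ⟨hd', h'⟩ | ⟨hd', h'⟩ | ⟨hd', h'⟩ <;>
  first
  | exact absurd hd' (by decide)
  | simp only at h h' hlt ⊢
    omega

lemma hasExitRays_hexagonal (z : ℤ × ℤ) (N : ℤ) :
    HasExitRays (box z N : Set (Site .hexagonal)) := by
  have hexit : ∀ x : Site .hexagonal, x ∉ box z N →
      (∃ y ∈ box z N, (graph .hexagonal).Adj x y) → ∃ d, IsHexExit z N x d := by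
    rintro ⟨⟨a, b⟩, k⟩ hx ⟨⟨⟨a', b'⟩, k'⟩, hy, hxy⟩
    rw [adj_hexagonal] at hxy
    simp only [box, mem_ofPred_eq] at hx hy hxy
    simp only [IsHexExit, exists_or, exists_eq_left]
    omega
  refine ⟨finite_box z N, fun x hx y hy hxy hadj hxd hyd => ?_⟩
  obtain ⟨d, hd⟩ := hexit x hx hxd
  obtain ⟨d', hd'⟩ := hexit y hy hyd
  by_cases hdd : d = d'
  · subst hdd
    have hlt : d.1 * (y.1.2 - x.1.2) + d.2 * (y.1.1 - x.1.1) < 0 ∨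
        d.1 * (x.1.2 - y.1.2) + d.2 * (x.1.1 - y.1.1) < 0 := by
      obtain ⟨⟨a, b⟩, k⟩ := x
      obtain ⟨⟨a', b'⟩, k'⟩ := y
      simp only [ne_eq, Prod.ext_iff, Fin.ext_iff] at hxy
      rcases hd with ⟨rfl, h⟩ | ⟨rfl, h⟩ | ⟨rfl, h⟩ | ⟨rfl, h⟩ <;>
      rcases hd' with ⟨hd', h'⟩ | ⟨hd', h'⟩ | ⟨hd', h'⟩ | ⟨hd', h'⟩ <;>
      first
      | exact absurd hd' (by decide)
      | simp only at h h' ⊢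
        omega
    rcases hlt with hlt | hlt
    · exact ⟨_, _, zigzagRay_zero x d _, zigzagRay_zero y d _, isExitRay_zigzagRay hd (Or.inl rfl),
        isExitRay_zigzagRay hd' (Or.inr rfl), separated_zigzagRay_of_lt hd hd' hlt⟩
    · exact ⟨_, _, zigzagRay_zero x d _, zigzagRay_zero y d _, isExitRay_zigzagRay hd (Or.inr rfl),
        isExitRay_zigzagRay hd' (Or.inl rfl), (separated_zigzagRay_of_lt hd' hd hlt).symm⟩
  · exact ⟨_, _, zigzagRay_zero x d _, zigzagRay_zero y d' _,
      isExitRay_zigzagRay hd (Or.inl rfl), isExitRay_zigzagRay hd' (Or.inl rfl),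
      separated_zigzagRay_of_ne hd hd' hdd⟩

lemma hasExitRays_box {L : Lattice} (z : ℤ × ℤ) (N : ℤ) : HasExitRays (box z N : Set (Site L)) := by
  cases L
  exacts [hasExitRays_square z N, hasExitRays_triangular z N, hasExitRays_hexagonal z N]

variable {L : Lattice}

/-! ### Translations and the range of an enhancement -/

lemma pos_translate (v : ℤ × ℤ) (x : Site L) :
    pos (translate v x) = ((v.1 : ℝ) • L.e₁ + (v.2 : ℝ) • L.e₂) + pos x := by
  simp only [pos, translate, Prod.fst_add, Prod.snd_add, Int.cast_add, add_smul]
  abel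

lemma translate_translate (v w : ℤ × ℤ) (x : Site L) :
    translate v (translate w x) = translate (v + w) x := by
  simp [translate, add_assoc]

lemma translate_zero (x : Site L) : translate 0 x = x := by simp [translate]

lemma translate_injective (v : ℤ × ℤ) : Function.Injective (translate (L := L) v) := by
  intro x y h
  have := congrArg (translate (-v)) h
  simpa [translate_translate, translate_zero] using this

lemma adj_translate (v : ℤ × ℤ) (x y : Site L) :
    (graph L).Adj (translate v x) (translate v y) ↔ (graph L).Adj x y := by
  change dist _ _ = 1 ↔ dist _ _ = 1
  rw [pos_translate, pos_translate, dist_add_left]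

lemma hasBiinfinite_preimage_translate (v : ℤ × ℤ) {ω : Set (Site L)}
    (h : HasBiinfiniteSelfRepellingPath ω) :
    HasBiinfiniteSelfRepellingPath {y | translate v y ∈ ω} := by
  obtain ⟨γ, hinj, hmem, hadj⟩ := h
  refine ⟨fun i => translate (-v) (γ i), (translate_injective _).comp hinj, fun i => ?_,
    fun i j => by rw [adj_translate, hadj]⟩
  simpa [translate_translate, translate_zero] using hmem i

lemma Enhancement.at_origin_cell (φ : Enhancement L) (k : Fin L.numClasses) (ω : Set (Site L)) :
    φ.at ((0, 0), k) ω = φ.toFun k ω := by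
  have : ∀ y : Site L, translate (0, 0) y = y := translate_zero
  simp [Enhancement.at, this]

/-- By translation invariance, a nonessential enhancement creates no doubly-infinite
self-repelling path wherever it is activated. -/
lemma Enhancement.not_hasBiinfinite_union_at {φ : Enhancement L} (hness : ¬ φ.IsEssential)
    (z : Site L) {ω : Set (Site L)} (hω : ¬ HasBiinfiniteSelfRepellingPath ω) :
    ¬ HasBiinfiniteSelfRepellingPath (ω ∪ φ.at z ω) := by
  intro h
  refine hness ⟨z.2, {y | translate z.1 y ∈ ω}, fun h' => hω ?_, ?_⟩
  · simpa [translate_translate, translate_zero] using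
      hasBiinfinite_preimage_translate (-z.1) h'
  · rw [φ.at_origin_cell]
    have := hasBiinfinite_preimage_translate z.1 h
    convert this using 1
    ext y
    simp only [mem_union, mem_ofPred_eq, Enhancement.at]
    rw [(translate_injective z.1).mem_set_image]

/-- Balls are contained in boxes. -/
lemma exists_ball_subset_box (L : Lattice) (R : ℝ) : ∃ N : ℤ, 0 ≤ N ∧
    ∀ (k : Fin L.numClasses) (y : Site L), dist (pos y) (pos (((0, 0), k) : Site L)) ≤ R →
      y ∈ (box (0, 0) N : Set (Site L)) := by
  refine ⟨⌈4 * |R| + 4⌉, by positivity, fun k y hy => ?_⟩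
  have hR : dist (pos y) (pos (((0, 0), k) : Site L)) ≤ |R| := hy.trans (le_abs_self R)
  have hsq := sq_dist_pos y ((0, 0), k)
  have hsq' : dist (pos y) (pos (((0, 0), k) : Site L)) ^ 2 ≤ |R| ^ 2 :=
    pow_le_pow_left₀ dist_nonneg hR 2
  have h0 : |pos y 0 - pos (((0, 0), k) : Site L) 0| ≤ |R| :=
    abs_le_of_sq_le_sq (by nlinarith [sq_nonneg (pos y 1 - pos (((0, 0), k) : Site L) 1)])
      (abs_nonneg R)
  have h1 : |pos y 1 - pos (((0, 0), k) : Site L) 1| ≤ |R| :=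
    abs_le_of_sq_le_sq (by nlinarith [sq_nonneg (pos y 0 - pos (((0, 0), k) : Site L) 0)])
      (abs_nonneg R)
  have hceil := Int.le_ceil (4 * |R| + 4)
  have hR0 := abs_nonneg R
  generalize |R| = r at *
  generalize ⌈4 * r + 4⌉ = M at *
  have h3 : (1.7 : ℝ) ≤ √3 := Real.le_sqrt_of_sq_le (by norm_num)
  have h3' : √3 ≤ 2 := Real.sqrt_le_iff.2 (by norm_num)
  have key : (|(y.1.1 : ℝ)| ≤ 4 * r + 4) ∧ |(y.1.2 : ℝ)| ≤ 4 * r + 4 := by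
    cases L with
    | square =>
      rw [(pos_square _).1, (pos_square _).1] at h0
      rw [(pos_square _).2, (pos_square _).2] at h1
      simp only [Int.cast_zero, sub_zero] at h0 h1
      constructor <;> linarith
    | triangular =>
      rw [(pos_triangular _).1, (pos_triangular _).1] at h0
      rw [(pos_triangular _).2, (pos_triangular _).2] at h1
      simp only [Int.cast_zero, zero_mul, zero_div, add_zero, sub_zero] at h0 h1
      rw [abs_mul, abs_of_pos (by positivity : (0 : ℝ) < √3 / 2)] at h1
      have h2 : |(y.1.2 : ℝ)| ≤ 2 * r := by nlinarith [abs_nonneg (y.1.2 : ℝ)]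
      rw [abs_le] at h0 h2
      rw [abs_le, abs_le]
      constructor <;> constructor <;> linarith
    | hexagonal =>
      rw [(pos_hexagonal _).1, (pos_hexagonal _).1] at h0
      rw [(pos_hexagonal _).2, (pos_hexagonal _).2] at h1
      simp only [Int.cast_zero, zero_mul, mul_zero, add_zero, zero_add, sub_zero] at h0 h1
      rw [abs_mul, abs_of_pos (by positivity : (0 : ℝ) < √3 / 2)] at h1
      have h2 : |(y.1.1 : ℝ) - y.1.2| ≤ 2 * r := by
        nlinarith [abs_nonneg ((y.1.1 : ℝ) - y.1.2)]
      have hk : ((k : ℕ) : ℝ) ≤ 1 := by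
        have : (k : ℕ) < 2 := k.isLt
        exact_mod_cast Nat.le_of_lt_succ this
      have hk' : ((y.2 : ℕ) : ℝ) ≤ 1 := by
        have : (y.2 : ℕ) < 2 := y.2.isLt
        exact_mod_cast Nat.le_of_lt_succ this
      have hk0 : (0 : ℝ) ≤ ((k : ℕ) : ℝ) := Nat.cast_nonneg _
      have hk0' : (0 : ℝ) ≤ ((y.2 : ℕ) : ℝ) := Nat.cast_nonneg _
      rw [abs_le] at h0 h2
      rw [abs_le, abs_le]
      constructor <;> constructor <;> linarith
  have hM : (|(y.1.1 : ℝ)| ≤ M) ∧ |(y.1.2 : ℝ)| ≤ M :=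
    ⟨key.1.trans hceil, key.2.trans hceil⟩
  rw [abs_le, abs_le] at hM
  simp only [box, mem_ofPred_eq, zero_sub, zero_add]
  exact_mod_cast hM

/-- A box that contains the range of all local functions of the enhancement. -/
lemma Enhancement.exists_box (φ : Enhancement L) : ∃ N : ℤ, 0 ≤ N ∧
    (∀ (z : Site L) (ω : Set (Site L)), φ.at z ω ⊆ box z.1 N) ∧
    ∀ (z : Site L) (ω ω' : Set (Site L)), ω ∩ box z.1 N = ω' ∩ box z.1 N →
      φ.at z ω = φ.at z ω' := by
  obtain ⟨N, hN0, hN⟩ := exists_ball_subset_box L φ.range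
  have hbox : ∀ (v : ℤ × ℤ) (y : Site L), y ∈ (box (0, 0) N : Set (Site L)) →
      translate v y ∈ (box v N : Set (Site L)) := by
    intro v y hy
    simp only [box, translate, mem_ofPred_eq, Prod.fst_add, Prod.snd_add] at hy ⊢
    omega
  refine ⟨N, hN0, ?_, ?_⟩
  · rintro z ω _ ⟨y, hy, rfl⟩
    exact hbox _ _ (hN z.2 y (φ.subset_ball _ _ y hy))
  · intro z ω ω' h
    rw [Enhancement.at, Enhancement.at]
    congr 1
    refine φ.depends_only _ _ _ fun y hy => ?_
    have := Set.ext_iff.1 h (translate z.1 y)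
    simpa [hbox z.1 y (hN z.2 y hy)] using this

lemma Enhancement.IsMonotonic.at_mono {φ : Enhancement L} (hmono : φ.IsMonotonic) (z : Site L)
    {ω ω' : Set (Site L)} (h : ω ⊆ ω') : φ.at z ω ⊆ φ.at z ω' :=
  image_mono (hmono _ _ _ fun _ hy => h hy)

lemma Enhancement.IsMonotonic.enhance_mono {φ : Enhancement L} (hmono : φ.IsMonotonic)
    (α : Set (Site L)) {ω ω' : Set (Site L)} (h : ω ⊆ ω') : φ.enhance ω α ⊆ φ.enhance ω' α :=
  union_subset_union h (iUnion₂_mono fun z _ => hmono.at_mono z h)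

lemma Enhancement.enhance_mono_right (φ : Enhancement L) (ω : Set (Site L))
    {α α' : Set (Site L)} (h : α ⊆ α') : φ.enhance ω α ⊆ φ.enhance ω α' :=
  union_subset_union_right _ (biUnion_subset_biUnion_left h)

lemma Enhancement.subset_enhance (φ : Enhancement L) (ω α : Set (Site L)) :
    ω ⊆ φ.enhance ω α := subset_union_left

/-! ### Segments -/

/-- The sites of the cells `(a, b)` with `|a - x₁| ≤ M` and `b = x₂`, a finite connected set. -/
def segment (x : Site L) (M : ℤ) : Set (Site L) :=
  {y | (x.1.1 - M ≤ y.1.1 ∧ y.1.1 ≤ x.1.1 + M) ∧ y.1.2 = x.1.2}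

lemma finite_segment (x : Site L) (M : ℤ) : (segment x M).Finite := by
  refine (((finite_Icc (x.1.1 - M) (x.1.1 + M)).prod (finite_singleton x.1.2)).prod
    (finite_univ (α := Fin L.numClasses))).subset ?_
  rintro y hy
  exact ⟨hy, mem_univ _⟩

/-- A bound, independent of the site `x`, for the number of sites of a segment. -/
lemma ncard_segment_le (x : Site L) (M : ℤ) :
    (segment x M).ncard ≤ 2 * (2 * M + 1).toNat := by
  have h : (segment x M) ⊆ (((Icc (x.1.1 - M) (x.1.1 + M)) ×ˢ {x.1.2}) ×ˢ univ) :=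
    fun y hy => ⟨hy, mem_univ _⟩
  have hfin : ((((Icc (x.1.1 - M) (x.1.1 + M)) ×ˢ {x.1.2}) ×ˢ univ) : Set (Site L)).Finite :=
    ((finite_Icc _ _).prod (finite_singleton _)).prod finite_univ
  have hL : L.numClasses ≤ 2 := by cases L <;> simp [Lattice.numClasses]
  refine (ncard_le_ncard h hfin).trans ?_
  rw [ncard_prod, ncard_prod, ncard_singleton, ncard_univ, mul_one, Nat.card_eq_fintype_card,
    Fintype.card_fin, mul_comm, ← Finset.coe_Icc, ncard_coe_finset, Int.card_Icc]
  refine Nat.mul_le_mul hL (le_of_eq ?_)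
  congr 1
  ring

/-- The sites `(a, b, k)` and `(a + 1, b, k)` are connected in their two cells. -/
lemma reachable_succ {ω : Set (Site L)} {a b : ℤ} (h : ∀ k, ((a, b), k) ∈ ω)
    (h' : ∀ k, ((a + 1, b), k) ∈ ω) (k : Fin L.numClasses) :
    (openGraph (graph L) ω).Reachable ((a, b), k) ((a + 1, b), k) := by
  cases L with
  | square =>
    refine SimpleGraph.Adj.reachable ⟨?_, h k, h' k⟩
    rw [adj_square]
    simp
  | triangular =>
    refine SimpleGraph.Adj.reachable ⟨?_, h k, h' k⟩
    rw [adj_triangular]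
    simp
  | hexagonal =>
    have hk : (k : ℕ) < 2 := k.isLt
    have h0 : (openGraph (graph .hexagonal) ω).Reachable ((a, b), ⟨1, one_lt_two⟩)
        ((a + 1, b), ⟨0, two_pos⟩) := by
      refine SimpleGraph.Adj.reachable ⟨?_, h _, h' _⟩
      rw [adj_hexagonal]
      simp
    have h1 : ∀ c : ℤ, (∀ k, ((c, b), k) ∈ ω) →
        (openGraph (graph .hexagonal) ω).Reachable ((c, b), ⟨0, two_pos⟩)
          ((c, b), ⟨1, one_lt_two⟩) := by
      intro c hc
      refine SimpleGraph.Adj.reachable ⟨?_, hc _, hc _⟩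
      rw [adj_hexagonal]
      simp
    have hk' : k = ⟨0, two_pos⟩ ∨ k = ⟨1, one_lt_two⟩ := by
      rcases (show (k : ℕ) = 0 ∨ (k : ℕ) = 1 by omega) with h | h
      · exact Or.inl (Fin.ext h)
      · exact Or.inr (Fin.ext h)
    rcases hk' with rfl | rfl
    · exact (h1 a h).trans h0
    · exact h0.trans (h1 (a + 1) h')

lemma mem_segment_self (x : Site L) {M : ℤ} (hM : 0 ≤ M) : x ∈ segment x M :=
  ⟨⟨by omega, by omega⟩, rfl⟩

/-- The end of a segment that lies farther away from the box is outside the box and connected to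
the centre of the segment. -/
lemma exists_reachable_notMem_box (x : Site L) (z : ℤ × ℤ) {N : ℤ} (hN : 0 ≤ N)
    {ω : Set (Site L)} (hω : segment x (N + 1) ⊆ ω) :
    ∃ y ∉ (box z N : Set (Site L)), (openGraph (graph L) ω).Reachable x y := by
  obtain ⟨⟨a, b⟩, k⟩ := x
  have hcol : ∀ c : ℤ, a - (N + 1) ≤ c → c ≤ a + (N + 1) → ∀ k, ((c, b), k) ∈ ω :=
    fun c h1 h2 k => hω ⟨⟨h1, h2⟩, rfl⟩
  have hright : ∀ n : ℕ, (n : ℤ) ≤ N + 1 →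
      (openGraph (graph L) ω).Reachable ((a, b), k) ((a + n, b), k) := by
    intro n
    induction n with
    | zero => intro _; simp
    | succ n ih =>
      intro hn
      push_cast at hn
      have := reachable_succ (hcol (a + n) (by omega) (by omega))
        (hcol (a + n + 1) (by omega) (by omega)) k
      rw [add_assoc] at this
      push_cast
      exact (ih (by omega)).trans this
  have hleft : ∀ n : ℕ, (n : ℤ) ≤ N + 1 →
      (openGraph (graph L) ω).Reachable ((a, b), k) ((a - n, b), k) := by
    intro n
    induction n with
    | zero => intro _; simp
    | succ n ih =>
      intro hn
      push_cast at hn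
      have := reachable_succ (hcol (a - n - 1) (by omega) (by omega))
        (hcol (a - n - 1 + 1) (by omega) (by omega)) k
      rw [sub_add_cancel, sub_sub] at this
      push_cast
      exact (ih (by omega)).trans this.symm
  have hcast : ((N + 1).toNat : ℤ) = N + 1 := Int.toNat_of_nonneg (by omega)
  rcases le_or_gt z.1 a with h | h
  · refine ⟨_, ?_, hright (N + 1).toNat hcast.le⟩
    simp only [box, mem_ofPred_eq]
    omega
  · refine ⟨_, ?_, hleft (N + 1).toNat hcast.le⟩
    simp only [box, mem_ofPred_eq]
    omega

/-! ### Comparison of clusters in the enhanced and in the initial configuration -/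

/-- A path in the enhanced configuration uses finitely many activations. -/
lemma Enhancement.exists_finset_reachable (φ : Enhancement L) {ω α : Set (Site L)} {x y : Site L}
    (h : (openGraph (graph L) (φ.enhance ω α)).Reachable x y) :
    ∃ F : Finset (Site L), (openGraph (graph L) (φ.enhance ω F)).Reachable x y := by
  classical
  have hmem : ∀ v ∈ φ.enhance ω α, ∃ F : Finset (Site L), v ∈ φ.enhance ω F := by
    rintro v (hv | hv)
    · exact ⟨∅, Or.inl hv⟩
    · obtain ⟨z, -, hz⟩ := mem_iUnion₂.1 hv
      exact ⟨{z}, Or.inr (mem_iUnion₂.2 ⟨z, by simp, hz⟩)⟩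
  rw [SimpleGraph.reachable_iff_reflTransGen] at h
  induction h with
  | refl => exact ⟨∅, SimpleGraph.Reachable.refl _⟩
  | tail _ h ih =>
    obtain ⟨F, hF⟩ := ih
    obtain ⟨F₁, h₁⟩ := hmem _ h.2.1
    obtain ⟨F₂, h₂⟩ := hmem _ h.2.2
    have hsub : ∀ F' ⊆ F ∪ (F₁ ∪ F₂), φ.enhance ω F' ⊆ φ.enhance ω ↑(F ∪ (F₁ ∪ F₂)) :=
      fun F' hF' => φ.enhance_mono_right ω (Finset.coe_subset.2 hF')
    refine ⟨F ∪ (F₁ ∪ F₂), (hF.mono (openGraph_mono (hsub F (by simp)))).trans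
      (SimpleGraph.Adj.reachable ⟨h.1, hsub F₁ ?_ h₁, hsub F₂ ?_ h₂⟩)⟩
    · exact Finset.subset_union_left.trans Finset.subset_union_right
    · exact Finset.subset_union_right.trans Finset.subset_union_right

/-- A monotonic nonessential enhancement connects no two sites that are centres of open segments
longer than its range. -/
lemma Enhancement.exists_reachable_of_enhance {φ : Enhancement L} (hmono : φ.IsMonotonic)
    (hness : ¬ φ.IsEssential) : ∃ M : ℤ, 0 ≤ M ∧ ∀ (ω α : Set (Site L)) (x y : Site L),
      segment x M ⊆ ω → segment y M ⊆ ω →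
      (openGraph (graph L) (φ.enhance ω α)).Reachable x y →
      (openGraph (graph L) ω).Reachable x y := by
  classical
  obtain ⟨N, hN0, hsub, hdep⟩ := φ.exists_box
  refine ⟨N + 1, by omega, fun ω α x y hx hy h => ?_⟩
  obtain ⟨F, hF⟩ := φ.exists_finset_reachable h
  clear h
  induction F using Finset.induction_on with
  | empty => simpa [Enhancement.enhance] using hF
  | insert z F _ ih =>
    apply ih
    set ω' := φ.enhance ω F with hω'
    have hωω' : ω ⊆ ω' := φ.subset_enhance ω F
    -- the activation at `z` is postponed until after those in `F`
    have hle : φ.enhance ω ↑(insert z F) ⊆ ω' ∪ φ.at z ω' := by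
      rintro v (hv | hv)
      · exact Or.inl (hωω' hv)
      · obtain ⟨z', hz', hv'⟩ := mem_iUnion₂.1 hv
        rcases Finset.mem_insert.1 (Finset.mem_coe.1 hz') with rfl | hz'
        · exact Or.inr (hmono.at_mono _ hωω' hv')
        · exact Or.inl (Or.inr (mem_iUnion₂.2 ⟨z', hz', hv'⟩))
    obtain ⟨u, huD, hxu⟩ := exists_reachable_notMem_box x z.1 hN0 (hx.trans hωω')
    obtain ⟨v, hvD, hyv⟩ := exists_reachable_notMem_box y z.1 hN0 (hy.trans hωω')
    have huv : (openGraph (graph L) (ω' ∪ φ.at z ω')).Reachable u v :=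
      ((hxu.mono (openGraph_mono subset_union_left)).symm.trans
        (hF.mono (openGraph_mono hle))).trans (hyv.mono (openGraph_mono subset_union_left))
    refine (hxu.trans (reachable_of_reachable_union (hasExitRays_box z.1 N) (hsub z ω') ?_
      huD hvD huv)).trans hyv.symm
    intro ω'' h hno
    rw [← hdep z ω'' ω' h]
    exact φ.not_hasBiinfinite_union_at hness z hno

lemma cluster_mono {ω ω' : Set (Site L)} (h : ω ⊆ ω') (x : Site L) :
    cluster ω x ⊆ cluster ω' x := by
  rintro y ⟨w, hw⟩
  exact ⟨w, fun z hz => h (hw z hz)⟩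

/-- A finite cluster of `x` cannot be joined to a distant site `y` by opening the segment
around `y`. -/
lemma exists_not_reachable_of_finite {ω : Set (Site L)} {x : Site L} (hx : x ∈ ω)
    (hfin : (cluster ω x).Finite) {M : ℤ} (hM : 0 ≤ M) {C : Set (Site L)} (hC : C.Infinite) :
    ∃ y ∈ C, ¬ (openGraph (graph L) (ω ∪ segment y M)).Reachable x y := by
  have hfinite : (⋃ c ∈ cluster ω x, {y : Site L | ((c.1.1 - (M + 1) ≤ y.1.1 ∧
      y.1.1 ≤ c.1.1 + (M + 1)) ∧ c.1.2 - 1 ≤ y.1.2 ∧ y.1.2 ≤ c.1.2 + 1)}).Finite := by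
    refine hfin.biUnion fun c _ => ?_
    refine (((finite_Icc (c.1.1 - (M + 1)) (c.1.1 + (M + 1))).prod
      (finite_Icc (c.1.2 - 1) (c.1.2 + 1))).prod (finite_univ (α := Fin L.numClasses))).subset ?_
    rintro y hy
    exact ⟨hy, mem_univ _⟩
  obtain ⟨y, hyC, hy⟩ := hC.exists_notMem_finite hfinite
  refine ⟨y, hyC, fun h => ?_⟩
  have hfar : ∀ c ∈ cluster ω x, ∀ v ∈ segment y M, v ≠ c ∧ ¬ (graph L).Adj c v := by
    intro c hc v hv
    have hy' : ¬ ((c.1.1 - (M + 1) ≤ y.1.1 ∧ y.1.1 ≤ c.1.1 + (M + 1)) ∧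
        c.1.2 - 1 ≤ y.1.2 ∧ y.1.2 ≤ c.1.2 + 1) := fun h => hy (mem_iUnion₂.2 ⟨c, hc, h⟩)
    simp only [segment, mem_ofPred_eq] at hv
    refine ⟨?_, fun hadj => ?_⟩
    · rintro rfl
      omega
    · cases L with
      | square => rw [adj_square] at hadj; omega
      | triangular => rw [adj_triangular] at hadj; omega
      | hexagonal => rw [adj_hexagonal] at hadj; omega
  have key : ∀ v, (openGraph (graph L) (ω ∪ segment y M)).Reachable x v → v ∈ cluster ω x := by
    intro v hv
    rw [SimpleGraph.reachable_iff_reflTransGen] at hv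
    induction hv with
    | refl => exact mem_cluster_iff.2 ⟨hx, SimpleGraph.Reachable.refl _⟩
    | tail _ hadj ih =>
      have hmem := hadj.2.2.resolve_right fun h => (hfar _ ih _ h).2 hadj.1
      obtain ⟨-, hr⟩ := mem_cluster_iff.1 ih
      exact mem_cluster_iff.2 ⟨hx, hr.trans
        (SimpleGraph.Adj.reachable ⟨hadj.1, mem_of_reachable_openGraph hx hr, hmem⟩)⟩
  exact (hfar y (key y h) y (mem_segment_self y hM)).1 rfl

/-- The deterministic comparison: up to opening the segments around the end points, a monotonic
nonessential enhancement does not change the clusters. -/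
lemma Enhancement.exists_cluster_comparison {φ : Enhancement L} (hmono : φ.IsMonotonic)
    (hness : ¬ φ.IsEssential) : ∃ M : ℤ, ∀ (ω α : Set (Site L)) (x : Site L),
      (∀ y ∈ cluster (φ.enhance ω α) x, y ∈ cluster (ω ∪ (segment x M ∪ segment y M)) x) ∧
      ((cluster (φ.enhance ω α) x).Infinite → (cluster (ω ∪ segment x M) x).Infinite) := by
  obtain ⟨M, hM, h⟩ := φ.exists_reachable_of_enhance hmono hness
  have key : ∀ (ω α : Set (Site L)) (x y : Site L), y ∈ cluster (φ.enhance ω α) x →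
      (openGraph (graph L) (ω ∪ (segment x M ∪ segment y M))).Reachable x y := by
    intro ω α x y hy
    refine h _ α x y (subset_union_left.trans subset_union_right)
      (subset_union_right.trans subset_union_right) ?_
    exact (mem_cluster_iff.1 hy).2.mono (openGraph_mono (hmono.enhance_mono α subset_union_left))
  refine ⟨M, fun ω α x => ⟨fun y hy => mem_cluster_iff.2 ⟨?_, key ω α x y hy⟩, fun hinf => ?_⟩⟩
  · exact Or.inr (Or.inl (mem_segment_self x hM))
  · by_contra hfin
    obtain ⟨y, hy, hno⟩ := exists_not_reachable_of_finite (Or.inr (mem_segment_self x hM))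
      (not_infinite.1 hfin) hM hinf
    rw [union_assoc] at hno
    exact hno (key ω α x y hy)

/-! ### Finite energy -/

section FiniteEnergy

variable {ι : Type*}

lemma measurableSet_superset (F : Finset ι) : MeasurableSet {ω : Set ι | ↑F ⊆ ω} := by
  have : {ω : Set ι | ↑F ⊆ ω} = ⋂ i ∈ F, {ω : Set ι | i ∈ ω} := by
    ext ω
    simp [subset_def]
  rw [this]
  exact F.measurableSet_biInter fun i _ => measurableSet_setOfPred.2 (measurable_set_mem i)

/-- The one-site marginal of the Bernoulli measure, as a measure on `Prop`. -/
def siteLaw (p : I) : Measure Prop :=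
  toNNReal p • Measure.dirac True + toNNReal (σ p) • Measure.dirac False

instance (p : I) : IsProbabilityMeasure (siteLaw p) := by
  constructor
  simp [siteLaw]

lemma siteLaw_true (p : I) : siteLaw p {True} = toNNReal p := by
  simp [siteLaw]

lemma setBernoulli_univ_apply (p : I) (S : Set (Set ι)) :
    setBernoulli univ p S =
      Measure.infinitePi (fun _ : ι => siteLaw p) ((fun f : ι → Prop => {i | f i}) ⁻¹' S) := by
  rw [setBernoulli_apply']
  simp [siteLaw]

lemma infinitePi_siteLaw_forall (p : I) (F : Finset ι) :
    Measure.infinitePi (fun _ : ι => siteLaw p) {f | ∀ i ∈ F, f i} = toNNReal p ^ F.card := by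
  have : {f : ι → Prop | ∀ i ∈ F, f i} = Set.pi F fun _ => {True} := by
    ext f
    simp [Set.pi]
  rw [this, Measure.infinitePi_pi _ fun _ _ => MeasurableSet.of_discrete]
  simp [siteLaw_true]

lemma setBernoulli_superset (p : I) (F : Finset ι) :
    setBernoulli univ p {ω : Set ι | ↑F ⊆ ω} = toNNReal p ^ F.card := by
  rw [setBernoulli_univ_apply, ← infinitePi_siteLaw_forall]
  rfl

/-- Opening the sites of a finite set `B` multiplies probabilities by at most `p ^ (-|B|)`: the
event that `ω ∪ B ∈ A` is independent of the configuration in `B`. -/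
lemma setBernoulli_union_mul_le (p : I) (B : Finset ι) {A : Set (Set ι)} (hA : MeasurableSet A) :
    setBernoulli univ p {ω | ω ∪ B ∈ A} * toNNReal p ^ B.card ≤ setBernoulli univ p A := by
  set μ := Measure.infinitePi (fun _ : ι => siteLaw p) with hμ
  have hind : iIndepFun (fun i (f : ι → Prop) => f i) μ :=
    iIndepFun_infinitePi (X := fun _ => id) fun _ => measurable_id
  rw [iIndepFun_iff_iIndep] at hind
  have h := indep_iSup_of_disjoint (fun i => (measurable_pi_apply i).comap_le) hind
    (disjoint_compl_left (a := (B : Set ι)))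
  rw [Indep_iff] at h
  have hm1 : MeasurableSet[⨆ i ∈ (B : Set ι)ᶜ, MeasurableSpace.comap
      (fun f : ι → Prop => f i) inferInstance] {f : ι → Prop | {i | f i} ∪ B ∈ A} := by
    have : @Measurable (ι → Prop) (Set ι) (⨆ i ∈ (B : Set ι)ᶜ, MeasurableSpace.comap
        (fun f : ι → Prop => f i) inferInstance) _ (fun f => {i | f i} ∪ B) := by
      refine (@measurable_set_iff ι (ι → Prop) (_) _).2 fun a => ?_
      by_cases ha : a ∈ B
      · simp [ha]
      · simp only [mem_union, mem_ofPred_eq, Finset.mem_coe, ha, or_false]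
        exact Measurable.mono (comap_measurable _) (le_iSup₂_of_le a (by simpa using ha) le_rfl)
          le_rfl
    exact this hA
  have hm2 : MeasurableSet[⨆ i ∈ (B : Set ι), MeasurableSpace.comap
      (fun f : ι → Prop => f i) inferInstance] {f : ι → Prop | ∀ i ∈ B, f i} := by
    have : {f : ι → Prop | ∀ i ∈ B, f i} = ⋂ i ∈ B, {f | f i} := by ext; simp
    rw [this]
    refine Finset.measurableSet_biInter _ fun i hi => ?_
    refine (le_iSup₂_of_le (f := fun i (_ : i ∈ (B : Set ι)) => MeasurableSpace.comap
      (fun f : ι → Prop => f i) inferInstance) i (by simpa using hi) le_rfl) _ ?_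
    exact ⟨{True}, .of_discrete, by ext; simp⟩
  have := h _ _ hm1 hm2
  rw [infinitePi_siteLaw_forall] at this
  rw [setBernoulli_univ_apply, setBernoulli_univ_apply]
  refine this.symm.le.trans (measure_mono ?_)
  rintro f ⟨hf, hB⟩
  have : {i | f i} ∪ B = {i | f i} := union_eq_left.2 fun i hi => hB i hi
  simpa [this] using hf

lemma setBernoulli_real_union_le {p : I} (hp : 0 < (p : ℝ)) {B : Set ι} (hB : B.Finite) {K : ℕ}
    (hK : B.ncard ≤ K) {A : Set (Set ι)} (hA : MeasurableSet A) :
    (setBernoulli univ p).real {ω | ω ∪ B ∈ A} ≤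
      (p : ℝ) ^ (-(K : ℝ)) * (setBernoulli univ p).real A := by
  lift B to Finset ι using hB
  rw [ncard_coe_finset] at hK
  have h := ENNReal.toReal_mono (measure_ne_top _ _) (setBernoulli_union_mul_le p B hA)
  rw [ENNReal.toReal_mul, ENNReal.toReal_pow, ENNReal.coe_toReal] at h
  change (setBernoulli univ p).real _ * (p : ℝ) ^ B.card ≤ (setBernoulli univ p).real A at h
  rw [Real.rpow_neg hp.le, Real.rpow_natCast, ← div_eq_inv_mul, le_div_iff₀ (by positivity)]
  exact (mul_le_mul_of_nonneg_left (pow_le_pow_of_le_one hp.le p.2.2 hK)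
    measureReal_nonneg).trans h

end FiniteEnergy

instance (p : I) : IsProbabilityMeasure (bernoulliSites L p) :=
  inferInstanceAs (IsProbabilityMeasure (setBernoulli univ p))

lemma measurableSet_mem_cluster (x y : Site L) : MeasurableSet {ω | y ∈ cluster ω x} := by
  classical
  have : {ω : Set (Site L) | y ∈ cluster ω x} =
      ⋃ F ∈ {F : Finset (Site L) | y ∈ cluster (F : Set (Site L)) x}, {ω | ↑F ⊆ ω} := by
    ext ω
    simp only [mem_ofPred_eq, mem_iUnion, exists_prop]
    constructor
    · rintro ⟨w, hw⟩
      exact ⟨w.support.toFinset, ⟨w, fun z hz => by simpa using hz⟩,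
        fun z hz => hw z (by simpa using hz)⟩
    · rintro ⟨F, hF, hsub⟩
      exact cluster_mono hsub x hF
  rw [this]
  exact MeasurableSet.biUnion (to_countable _) fun F _ => measurableSet_superset F

lemma measurableSet_infinite_cluster (x : Site L) :
    MeasurableSet {ω | (cluster ω x).Infinite} := by
  have : {ω : Set (Site L) | (cluster ω x).Infinite} =
      ⋂ F : Finset (Site L), ⋃ y ∈ (F : Set (Site L))ᶜ, {ω | y ∈ cluster ω x} := by
    ext ω
    simp only [mem_ofPred_eq, mem_iInter, mem_iUnion, exists_prop]
    constructor
    · intro h F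
      obtain ⟨y, hy, hyF⟩ := h.exists_notMem_finset F
      exact ⟨y, by simpa using hyF, hy⟩
    · intro h hfin
      obtain ⟨y, hy, hy'⟩ := h hfin.toFinset
      simp [hy'] at hy
  rw [this]
  exact MeasurableSet.iInter fun F => MeasurableSet.biUnion (to_countable _)
    fun y _ => measurableSet_mem_cluster x y

/-! ### Positivity of the critical probability -/

lemma cell_of_adj {x y : Site L} (h : (graph L).Adj x y) :
    (x.1.1 - 1 ≤ y.1.1 ∧ y.1.1 ≤ x.1.1 + 1) ∧ x.1.2 - 1 ≤ y.1.2 ∧ y.1.2 ≤ x.1.2 + 1 := by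
  cases L with
  | square => rw [adj_square] at h; omega
  | triangular => rw [adj_triangular] at h; omega
  | hexagonal => rw [adj_hexagonal] at h; omega

/-- The number of the vertex sets of paths of length `n` with a given start is at most `18 ^ n`:
each step leads to one of the nine neighbouring cells, with at most two sites each. -/
lemma exists_finset_paths (n : ℕ) (x : Site L) : ∃ T : Finset (Finset (Site L)),
    T.card ≤ 18 ^ n ∧ ∀ p : ℕ → Site L, p 0 = x → (∀ i < n, (graph L).Adj (p i) (p (i + 1))) →
      (Finset.range (n + 1)).image p ∈ T := by
  classical
  induction n generalizing x with
  | zero => exact ⟨{{x}}, by simp, fun p hp _ => by simp [hp]⟩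
  | succ n ih =>
    choose T hT hpath using ih
    let nb : Finset (Site L) := ((Finset.Icc (x.1.1 - 1) (x.1.1 + 1)) ×ˢ
      (Finset.Icc (x.1.2 - 1) (x.1.2 + 1))) ×ˢ Finset.univ
    have hnb : nb.card ≤ 18 := by
      have hL : L.numClasses ≤ 2 := by cases L <;> simp [Lattice.numClasses]
      have h3 : ∀ a : ℤ, (a + 1 + 1 - (a - 1)).toNat = 3 := fun a => by omega
      simp only [nb, Finset.card_product, Int.card_Icc, h3, Finset.card_univ, Fintype.card_fin]
      omega
    refine ⟨nb.biUnion fun y => (T y).image (insert x), ?_, fun p hp hadj => ?_⟩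
    · refine (Finset.card_biUnion_le_card_mul _ _ _ fun y _ =>
        Finset.card_image_le.trans (hT y)).trans ?_
      rw [pow_succ']
      exact Nat.mul_le_mul_right _ hnb
    · refine Finset.mem_biUnion.2 ⟨p 1, ?_, Finset.mem_image.2 ⟨_, hpath (p 1)
        (fun i => p (i + 1)) rfl fun i hi => hadj (i + 1) (by omega), ?_⟩⟩
      · have := cell_of_adj (hadj 0 (by omega))
        rw [hp] at this
        simpa [nb] using this
      · ext y
        simp only [Finset.mem_insert, Finset.mem_image, Finset.mem_range]
        constructor
        · rintro (rfl | ⟨i, hi, rfl⟩)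
          · exact ⟨0, by omega, hp⟩
          · exact ⟨i + 1, by omega, rfl⟩
        · rintro ⟨i, hi, rfl⟩
          cases i with
          | zero => exact Or.inl hp
          | succ i => exact Or.inr ⟨i, by omega, rfl⟩

/-- An infinite cluster contains self-avoiding paths of any length. -/
lemma exists_path_of_infinite_cluster {ω : Set (Site L)} {x : Site L}
    (h : (cluster ω x).Infinite) (n : ℕ) : ∃ p : ℕ → Site L, p 0 = x ∧
      (∀ i < n, (graph L).Adj (p i) (p (i + 1))) ∧ (∀ i ≤ n, p i ∈ ω) ∧
      ∀ i ≤ n, ∀ j ≤ n, p i = p j → i = j := by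
  obtain ⟨y, hy, hyn⟩ := h.exists_notMem_finite (finite_box x.1 n)
  obtain ⟨hx, hr⟩ := mem_cluster_iff.1 hy
  obtain ⟨m, p, h0, hm, hS, hinj, hadj⟩ := exists_induced_path hx hr
  have hbox : ∀ i : ℕ, i ≤ m → p i ∈ (box x.1 i : Set (Site L)) := by
    intro i
    induction i with
    | zero => intro _; simp [box, h0]
    | succ i ih =>
      intro hi
      have h1 := ih (by omega)
      have h2 := cell_of_adj ((hadj i (by omega) (i + 1) hi).2 (Or.inl rfl))
      simp only [box, mem_ofPred_eq] at h1 ⊢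
      push_cast
      omega
  have hnm : n ≤ m := by
    by_contra hlt
    refine hyn ?_
    have := hbox m le_rfl
    rw [hm] at this
    simp only [box, mem_ofPred_eq] at this ⊢
    omega
  exact ⟨p, h0, fun i hi => (hadj i (by omega) (i + 1) (by omega)).2 (Or.inl rfl),
    fun i hi => hS i (by omega), fun i hi j hj => hinj i (by omega) j (by omega)⟩

lemma theta_le_pow (L : Lattice) (p : I) (n : ℕ) : theta L p ≤ (18 * (p : ℝ)) ^ n := by
  classical
  obtain ⟨T, hT, hpath⟩ := exists_finset_paths n (origin L)
  have hsub : {ω : Set (Site L) | (cluster ω (origin L)).Infinite} ⊆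
      ⋃ F ∈ T.filter (fun F => F.card = n + 1), {ω | ↑F ⊆ ω} := by
    intro ω hω
    obtain ⟨q, h0, hadj, hmem, hinj⟩ := exists_path_of_infinite_cluster hω n
    refine mem_iUnion₂.2 ⟨_, Finset.mem_filter.2 ⟨hpath q h0 hadj, ?_⟩, ?_⟩
    · rw [Finset.card_image_of_injOn, Finset.card_range]
      intro i hi j hj hij
      simp only [Finset.coe_range, mem_Iio] at hi hj
      exact hinj i (by omega) j (by omega) hij
    · intro v hv
      simp only [Finset.coe_image, Finset.coe_range, mem_image, mem_Iio] at hv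
      obtain ⟨i, hi, rfl⟩ := hv
      exact hmem i (by omega)
  have hp0 : (0 : ℝ) ≤ p := p.2.1
  calc theta L p ≤ (bernoulliSites L p).real
        (⋃ F ∈ T.filter (fun F => F.card = n + 1), {ω | ↑F ⊆ ω}) := by
        exact measureReal_mono hsub (measure_ne_top _ _)
    _ ≤ ∑ F ∈ T.filter (fun F => F.card = n + 1),
        (bernoulliSites L p).real {ω | ↑F ⊆ ω} := measureReal_biUnion_finset_le _ _
    _ = ∑ F ∈ T.filter (fun F => F.card = n + 1), (p : ℝ) ^ (n + 1) := by
        refine Finset.sum_congr rfl fun F hF => ?_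
        rw [bernoulliSites, measureReal_def, setBernoulli_superset,
          (Finset.mem_filter.1 hF).2]
        simp
    _ ≤ (18 : ℝ) ^ n * (p : ℝ) ^ n := by
        rw [Finset.sum_const, nsmul_eq_mul]
        refine mul_le_mul ?_ (pow_le_pow_of_le_one hp0 p.2.2 (Nat.le_succ n)) (by positivity)
          (by positivity)
        exact_mod_cast (Finset.card_filter_le _ _).trans hT
    _ = (18 * (p : ℝ)) ^ n := (mul_pow _ _ _).symm

lemma infinite_cluster_univ (L : Lattice) : (cluster univ (origin L)).Infinite := by
  refine infinite_of_injective_forall_mem (f := fun n : ℕ => (((n : ℤ), 0), 0)) ?_ fun n => ?_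
  · intro m n h
    simpa using h
  · refine mem_cluster_iff.2 ⟨mem_univ _, ?_⟩
    induction n with
    | zero => exact SimpleGraph.Reachable.refl _
    | succ n ih =>
      push_cast
      exact ih.trans (reachable_succ (fun _ => mem_univ _) (fun _ => mem_univ _) 0)

lemma theta_one (L : Lattice) : theta L 1 = 1 := by
  rw [theta, bernoulliSites, setBernoulli_one, measureReal_def,
    Measure.dirac_apply_of_mem (infinite_cluster_univ L), ENNReal.toReal_one]

lemma le_pc (L : Lattice) : 1 / 18 ≤ pc L := by
  refine le_csInf ⟨_, mem_image_of_mem _ (show (1 : I) ∈ {p : I | 0 < theta L p} by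
    simp [theta_one])⟩ ?_
  rintro _ ⟨p, hp, rfl⟩
  by_contra! hlt
  have hp0 : (0 : ℝ) ≤ p := p.2.1
  have hlim := tendsto_pow_atTop_nhds_zero_of_lt_one (r := 18 * (p : ℝ)) (by positivity)
    (by linarith)
  exact absurd (ge_of_tendsto' hlim (theta_le_pow L p)) (not_le.2 hp)

/-! ### Comparison of probabilities and of correlation lengths -/

instance (p s : I) : IsProbabilityMeasure (jointLaw L p s) :=
  inferInstanceAs (IsProbabilityMeasure ((bernoulliSites L p).prod (bernoulliSites L s)))

lemma jointLaw_real_fst (p s : I) (A : Set (Set (Site L))) :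
    (jointLaw L p s).real {c | c.1 ∈ A} = (bernoulliSites L p).real A := by
  have : {c : Set (Site L) × Set (Site L) | c.1 ∈ A} = A ×ˢ univ := by ext; simp
  rw [this, measureReal_def, measureReal_def, jointLaw, Measure.prod_prod, measure_univ, mul_one]

/-- If an enhanced event holds only when the initial one holds after opening a finite set of
sites, their probabilities are comparable. -/
lemma jointLaw_real_le {p : I} (hp : 0 < (p : ℝ)) (s : I) {A : Set (Set (Site L))}
    (hA : MeasurableSet A) {B : Set (Site L)} (hB : B.Finite) {K : ℕ} (hK : B.ncard ≤ K)
    {S : Set (Set (Site L) × Set (Site L))} (hS : ∀ c ∈ S, c.1 ∪ B ∈ A) :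
    (jointLaw L p s).real S ≤ (p : ℝ) ^ (-(K : ℝ)) * (bernoulliSites L p).real A :=
  calc (jointLaw L p s).real S
      ≤ (jointLaw L p s).real {c | c.1 ∈ {ω : Set (Site L) | ω ∪ B ∈ A}} :=
        measureReal_mono hS (measure_ne_top _ _)
    _ = (bernoulliSites L p).real {ω | ω ∪ B ∈ A} := jointLaw_real_fst _ _ _
    _ ≤ _ := setBernoulli_real_union_le hp hB hK hA

lemma Enhancement.theta_le_theta (φ : Enhancement L) (p s : I) :
    EnhPerc.theta L p ≤ φ.theta p s := by
  rw [EnhPerc.theta, ← jointLaw_real_fst p s]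
  exact measureReal_mono (fun c hc => Infinite.mono (cluster_mono (φ.subset_enhance _ _) _) hc)
    (measure_ne_top _ _)

lemma Enhancement.tau_le_tau (φ : Enhancement L) (p s : I) (x : Site L) :
    EnhPerc.tau L p x ≤ φ.tau p s x := by
  rw [EnhPerc.tau, ← jointLaw_real_fst p s]
  exact measureReal_mono (fun c hc => cluster_mono (φ.subset_enhance _ _) _ hc)
    (measure_ne_top _ _)

/-- For monotonic nonessential enhancements, percolation probability and connectivity function
of the enhanced process exceed those of the independent process at most by a power of `p`. -/
lemma Enhancement.exists_upper_bounds {φ : Enhancement L} (hmono : φ.IsMonotonic)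
    (hness : ¬ φ.IsEssential) : ∃ K : ℕ, ∀ p s : I, 0 < (p : ℝ) →
      φ.theta p s ≤ (p : ℝ) ^ (-(K : ℝ)) * EnhPerc.theta L p ∧
      ∀ x, φ.tau p s x ≤ (p : ℝ) ^ (-(K : ℝ)) * EnhPerc.tau L p x := by
  obtain ⟨M, hM⟩ := φ.exists_cluster_comparison hmono hness
  have hcard := fun x : Site L => ncard_segment_le x M
  generalize 2 * (2 * M + 1).toNat = K at hcard
  refine ⟨K + K, fun p s hp => ⟨?_, fun x => ?_⟩⟩
  · exact jointLaw_real_le hp s (measurableSet_infinite_cluster _)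
      (finite_segment (origin L) M) ((hcard _).trans (Nat.le_add_right K K))
      fun c hc => (hM c.1 c.2 _).2 hc
  · exact jointLaw_real_le hp s (measurableSet_mem_cluster _ _)
      ((finite_segment (origin L) M).union (finite_segment x M))
      ((ncard_union_le _ _).trans (add_le_add (hcard _) (hcard _)))
      fun c hc => (hM c.1 c.2 _).1 x hc

lemma decayRate_le_of_le {T T' : Site L → ℝ} {x : Site L} (h0 : 0 ≤ T x) (h : T x ≤ T' x)
    (h' : T x = 0 → T' x = 0) : decayRate T' x ≤ decayRate T x := by
  rcases h0.eq_or_lt with h0 | h0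
  · rw [decayRate, decayRate, h' h0.symm, ← h0]
  · refine ENNReal.ofReal_le_ofReal (mul_le_mul_of_nonpos_left (Real.log_le_log h0 h) ?_)
    exact neg_nonpos.2 (by positivity)

lemma decayRate_le_add {T T' : Site L → ℝ} {x : Site L} {C : ℝ} (h0 : 0 ≤ T x)
    (h : T x ≤ T' x) (h' : T' x ≤ Real.exp C * T x) :
    decayRate T x ≤ decayRate T' x + ENNReal.ofReal (C / ‖pos x‖) := by
  rcases h0.eq_or_lt with h0 | h0
  -- if `T x = 0`, then `T' x = 0`, and both rates take the same junk value `log 0 = 0`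
  · have : T' x = 0 := le_antisymm (by simpa [← h0] using h') (by rwa [← h0] at h)
    rw [decayRate, decayRate, this, ← h0]
    exact le_self_add
  · have hlog : Real.log (T' x) ≤ C + Real.log (T x) := by
      rw [← Real.log_exp C, ← Real.log_mul (Real.exp_ne_zero C) h0.ne']
      exact Real.log_le_log (h0.trans_le h) h'
    refine le_trans (ENNReal.ofReal_le_ofReal ?_) ENNReal.ofReal_add_le
    have hn : 0 ≤ 1 / ‖pos x‖ := by positivity
    have := mul_le_mul_of_nonneg_left hlog hn
    rw [div_eq_mul_one_div C]
    nlinarith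

/-- Connectivity functions that differ by at most a constant factor have the same exponential
decay rates. -/
lemma decayRate_asymptotics {T T' : Site L → ℝ} {C : ℝ} (h0 : ∀ x, 0 ≤ T x)
    (h : ∀ x, T x ≤ T' x) (h' : ∀ x, T' x ≤ Real.exp C * T x) {l : Filter (Site L)}
    (hl : l ≤ atInfinity L) :
    (∀ ξ, IsCorrelationLength T' l ξ ↔ IsCorrelationLength T l ξ) ∧
      correlationLength T' l = correlationLength T l := by
  have hle : ∀ x, decayRate T' x ≤ decayRate T x := fun x =>
    decayRate_le_of_le (h0 x) (h x) fun hx =>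
      le_antisymm (by simpa [hx] using h' x) ((h0 x).trans (h x))
  have hle' : ∀ x, decayRate T x ≤ decayRate T' x + ENNReal.ofReal (C / ‖pos x‖) := fun x =>
    decayRate_le_add (h0 x) (h x) (h' x)
  have hnorm : Tendsto (fun x : Site L => ‖pos x‖) l atTop := tendsto_comap.mono_left hl
  have hε : Tendsto (fun x : Site L => ENNReal.ofReal (C / ‖pos x‖)) l (𝓝 0) := by
    rw [← ENNReal.ofReal_zero]
    exact ENNReal.tendsto_ofReal (hnorm.const_div_atTop C)
  refine ⟨fun ξ => ⟨fun hξ => ?_, fun hξ => ?_⟩, ?_⟩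
  · refine tendsto_of_tendsto_of_tendsto_of_le_of_le hξ ?_ hle hle'
    simpa using Tendsto.add hξ hε
  · refine tendsto_of_tendsto_of_tendsto_of_le_of_le
      (g := fun x => decayRate T x - ENNReal.ofReal (C / ‖pos x‖)) ?_ hξ
      (fun x => tsub_le_iff_right.2 (hle' x)) hle
    simpa using ENNReal.Tendsto.sub hξ hε (Or.inr ENNReal.zero_ne_top)
  · refine congrArg (·⁻¹) (le_antisymm (liminf_le_liminf (Eventually.of_forall hle)) ?_)
    rw [← ENNReal.liminf_add_of_right_tendsto_zero hε (decayRate T')]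
    exact liminf_le_liminf (Eventually.of_forall hle')

end EnhPerc

end

theorem mainTheorem7 (L : EnhPerc.Lattice) (φ : EnhPerc.Enhancement L)
    (hmono : φ.IsMonotonic) (hness : ¬ φ.IsEssential) :
    ∃ c₁ c₂ r : ℝ, 0 < c₁ ∧ 0 < c₂ ∧ ∀ s : unitInterval,
      -- percolation probability
      (∀ p : unitInterval, EnhPerc.pc L < p →
        EnhPerc.theta L p ≤ φ.theta p s ∧ φ.theta p s ≤ c₁ * EnhPerc.theta L p) ∧
      -- connectivity function
      (∀ p : unitInterval, 0 < (p : ℝ) → (p : ℝ) ≤ EnhPerc.pc L →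
        ∀ x : EnhPerc.Site L, r ≤ ‖EnhPerc.pos x‖ →
          EnhPerc.tau L p x ≤ φ.tau p s x ∧
            φ.tau p s x ≤ (p : ℝ) ^ (-c₂) * EnhPerc.tau L p x) ∧
      -- correlation length, for every way `l` of letting `|x|` tend to infinity
      (∀ p : unitInterval, 0 < (p : ℝ) → (p : ℝ) ≤ EnhPerc.pc L →
        ∀ l : Filter (EnhPerc.Site L), l ≤ EnhPerc.atInfinity L →
          (∀ ξ : ENNReal, EnhPerc.IsCorrelationLength (φ.tau p s) l ξ ↔
            EnhPerc.IsCorrelationLength (EnhPerc.tau L p) l ξ) ∧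
          EnhPerc.correlationLength (φ.tau p s) l =
            EnhPerc.correlationLength (EnhPerc.tau L p) l) := by
  obtain ⟨K, hK⟩ := φ.exists_upper_bounds hmono hness
  -- `p ^ (-K) ≤ 18 ^ K` for `p > p_c`, as `p_c ≥ 1 / 18`; the second constant only has to be
  -- positive and at least `K`
  refine ⟨18 ^ K, K + 1, 0, by positivity, by positivity, fun s => ⟨fun p hp => ?_,
    fun p hp _ x _ => ⟨φ.tau_le_tau p s x, ((hK p s hp).2 x).trans ?_⟩, fun p hp _ l hl => ?_⟩⟩
  · have hp18 : (1 : ℝ) / 18 < p := (EnhPerc.le_pc L).trans_lt hp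
    have hp0 : (0 : ℝ) < p := lt_trans (by norm_num) hp18
    refine ⟨φ.theta_le_theta p s, ((hK p s hp0).1).trans
      (mul_le_mul_of_nonneg_right ?_ measureReal_nonneg)⟩
    rw [Real.rpow_neg hp0.le, Real.rpow_natCast, ← inv_pow]
    refine pow_le_pow_left₀ (by positivity) ?_ K
    rw [inv_le_comm₀ hp0 (by norm_num)]
    linarith
  · refine mul_le_mul_of_nonneg_right ?_ measureReal_nonneg
    exact Real.rpow_le_rpow_of_exponent_ge hp p.2.2 (by linarith)
  · refine EnhPerc.decayRate_asymptotics (C := Real.log p * -K)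
      (fun x => measureReal_nonneg) (φ.tau_le_tau p s) (fun x => ?_) hl
    rw [← Real.rpow_def_of_pos hp]
    exact (hK p s hp).2 x
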